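/- Let $L>0$, let $\mathbb T^2=(\mathbb R/L\mathbb Z)^2$ be the flat two-dimensional torus, and let $W^{k,2}(\mathbb T^2)$ be the Sobolev space of real functions whose weak derivatives up to order $k$ lie in $L^2(\mathbb T^2)$, with norm $\|v\|_{k,2}=\sum_{|\beta|\le k}\|\partial^\beta v\|_{L^2}$. Let $\mathbf u_h\in W^{3,2}(\mathbb T^2;\mathbb R^2)$ be weakly divergence-free, $f\in W^{2,2}(\mathbb T^2)$, $b_0\in W^{3,2}(\mathbb T^2)$ and $\omega_0\in W^{2,2}(\mathbb T^2)$. For $T>0$, a triple $(b,\omega,T)$ is called a (local strong) solution of the thermal quasi-geostrophic (TQG) equations with data $(\mathbf u_h,f,b_0,\omega_0)$ if $b\in C([0,T];W^{3,2}(\mathbb T^2))$, $\omega\in C([0,T];W^{2,2}(\mathbb T^2))$ and, for all $t\in[0,T]$, $$b(t)=b_0-\int_0^t \mathrm{div}(b\mathbf u)\,d\tau,\qquad \omega(t)=\omega_0-\int_0^t\big[\mathrm{div}((\omega-b)\mathbf u)+\mathrm{div}(b\mathbf u_h)\big]\,d\tau,$$ where the velocity at each time is $\mathbf u=\nabla^\perp\psi=(-\partial_y\psi,\partial_x\psi)$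 and the stream function $\psi\in W^{2,2}(\mathbb T^2)$ solves $\omega=(\Delta-1)\psi+f$. Let $(b^1,\omega^1,T^1)$ and $(b^2,\omega^2,T^2)$ be two solutions with the same data $(\mathbf u_h,f,b_0,\omega_0)$. Then $$\|(b^1-b^2)(t)\|_{2,2}^2+\|(\omega^1-\omega^2)(t)\|_{1,2}^2=0\qquad\text{for all } t\in[0,T],\quad T=\min\{T^1,T^2\}.$$ -/

import Mathlib

open MeasureTheory

noncomputable section

namespace TQG

/-- The flat two-dimensional torus `(ℝ / Lℤ)²`. -/
abbrev Torus (L : ℝ) : Type := Fin 2 → AddCircle L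

variable {L : ℝ} [Fact (0 < L)]

/-- The real Hilbert space `L²` of the torus, for Lebesgue measure. -/
abbrev L2 (L : ℝ) [Fact (0 < L)] : Type := Lp ℝ 2 (volume : Measure (Torus L))

/-- The classical partial derivative in the `i`-th coordinate of a function on the torus. -/
def pderiv (i : Fin 2) (φ : Torus L → ℝ) : Torus L → ℝ :=
  fun x => deriv (fun s : ℝ => φ (x + Pi.single i (s : AddCircle L))) 0

/-- The classical derivative `∂₀^β₀ ∂₁^β₁ φ` for a multi-index `β = (β₀, β₁)`. -/
def pderivs (β : ℕ × ℕ) (φ : Torus L → ℝ) : Torus L → ℝ :=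
  (pderiv 0)^[β.1] ((pderiv 1)^[β.2] φ)

/-- Test functions: the smooth functions on the torus, that is, those whose lift to a periodic
function on the plane is smooth. -/
def IsTest (φ : Torus L → ℝ) : Prop :=
  ContDiff ℝ (⊤ : ℕ∞) (fun y : Fin 2 → ℝ => φ (fun i => (y i : AddCircle L)))

/-- `w` is the weak derivative `∂^β v`. -/
def HasWeakDeriv (β : ℕ × ℕ) (v w : L2 L) : Prop :=
  ∀ φ : Torus L → ℝ, IsTest φ →
    ∫ x, v x * pderivs β φ x = (-1) ^ (β.1 + β.2) * ∫ x, w x * φ x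

/-- `v` belongs to the Sobolev space `W^{k,2}` of the torus. -/
def MemW (k : ℕ) (v : L2 L) : Prop :=
  ∀ β : ℕ × ℕ, β.1 + β.2 ≤ k → ∃ w : L2 L, HasWeakDeriv β v w

open Classical in
/-- The weak derivative `∂^β v` (with the value `0` if it does not exist in `L²`). -/
def weakDeriv (β : ℕ × ℕ) (v : L2 L) : L2 L :=
  if h : ∃ w : L2 L, HasWeakDeriv β v w then h.choose else 0

/-- The norm `∑_{|β| ≤ k} ‖∂^β v‖_{L²}` of `W^{k,2}`; meaningful for `v` with `MemW k v`. -/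
def sobolevNorm (k : ℕ) (v : L2 L) : ℝ :=
  ∑ m ∈ Finset.range (k + 1), ∑ β ∈ Finset.HasAntidiagonal.antidiagonal m, ‖weakDeriv β v‖

/-- `v ∈ C([0,T]; W^{k,2})`. -/
def ContInW (k : ℕ) (T : ℝ) (v : ℝ → L2 L) : Prop :=
  ∀ t ∈ Set.Icc 0 T, MemW k (v t) ∧
    Filter.Tendsto (fun s => sobolevNorm k (v s - v t)) (nhdsWithin t (Set.Icc 0 T)) (nhds 0)

/-- `g` is the weak divergence of the vector field `F`. -/
def HasWeakDiv (F : Fin 2 → Torus L → ℝ) (g : L2 L) : Prop :=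
  ∀ φ : Torus L → ℝ, IsTest φ →
    ∫ x, ∑ i, F i x * pderiv i φ x = - ∫ x, g x * φ x

/-- `u = ∇^⊥ ψ = (-∂₁ψ, ∂₀ψ)`, where the stream function `ψ` solves `ω = (Δ - 1) ψ + f`. -/
def IsVelocity (f ω : L2 L) (u : Fin 2 → L2 L) : Prop :=
  ∃ ψ : L2 L, MemW 2 ψ ∧
    ω = weakDeriv (2, 0) ψ + weakDeriv (0, 2) ψ - ψ + f ∧
    u 0 = -weakDeriv (0, 1) ψ ∧ u 1 = weakDeriv (1, 0) ψ

/-- The assumption on the data: `u_h ∈ W^{3,2}_div`, `f ∈ W^{2,2}`, `b₀ ∈ W^{3,2}`,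
`ω₀ ∈ W^{2,2}`. -/
structure IsData (uh : Fin 2 → L2 L) (f b₀ ω₀ : L2 L) : Prop where
  uh_mem : ∀ i, MemW 3 (uh i)
  uh_div : HasWeakDiv (fun i x => uh i x) 0
  f_mem : MemW 2 f
  b₀_mem : MemW 3 b₀
  ω₀_mem : MemW 2 ω₀

/-- `(b, ω, T)` is a local strong solution of the thermal quasi-geostrophic equations with data
`u_h`, `f`, `b₀`, `ω₀`. Here `P = div (b u)`, `Q = div ((ω - b) u)`, `R = div (b u_h)`, and the
time integrals are Bochner integrals in `L²`. Only the values on `[0, T]` matter. -/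
structure IsSolution (uh : Fin 2 → L2 L) (f b₀ ω₀ : L2 L) (b ω : ℝ → L2 L) (T : ℝ) : Prop where
  pos : 0 < T
  b_cont : ContInW 3 T b
  ω_cont : ContInW 2 T ω
  eqns : ∃ (u : ℝ → Fin 2 → L2 L) (P Q R : ℝ → L2 L),
    (∀ t ∈ Set.Icc 0 T,
      IsVelocity f (ω t) (u t) ∧
      HasWeakDiv (fun i x => b t x * u t i x) (P t) ∧
      HasWeakDiv (fun i x => (ω t x - b t x) * u t i x) (Q t) ∧
      HasWeakDiv (fun i x => b t x * uh i x) (R t)) ∧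
    IntervalIntegrable P volume 0 T ∧
    IntervalIntegrable Q volume 0 T ∧
    IntervalIntegrable R volume 0 T ∧
    (∀ t ∈ Set.Icc 0 T, b t = b₀ - ∫ τ in (0 : ℝ)..t, P τ) ∧
    (∀ t ∈ Set.Icc 0 T, ω t = ω₀ - ∫ τ in (0 : ℝ)..t, (Q τ + R τ))

end TQG

end

set_option linter.unusedSectionVars false

open MeasureTheory

noncomputable section

namespace TQG

/-! ### Test functions -/

section

variable {L : ℝ}

/-- The covering map of the torus by the plane. -/
def cover (L : ℝ) (y : Fin 2 → ℝ) : Torus L := fun i => (y i : AddCircle L)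

lemma isOpenQuotientMap_cover : IsOpenQuotientMap (cover L) :=
  IsOpenQuotientMap.piMap fun _ => QuotientAddGroup.isOpenQuotientMap_mk

lemma cover_surjective : Function.Surjective (cover L) := isOpenQuotientMap_cover.surjective

lemma cover_add_single (y : Fin 2 → ℝ) (i : Fin 2) (s : ℝ) :
    cover L y + Pi.single i (s : AddCircle L) = cover L (y + s • Pi.single i (1 : ℝ)) := by
  funext j
  by_cases h : j = i
  · subst h; simp [cover]
  · simp [cover, h]

lemma IsTest.differentiable {φ : Torus L → ℝ} (hφ : IsTest φ) :
    Differentiable ℝ (φ ∘ cover L) :=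
  ContDiff.differentiable hφ (by simp)

lemma IsTest.pderiv_cover {φ : Torus L → ℝ} (hφ : IsTest φ) (i : Fin 2) (y : Fin 2 → ℝ) :
    pderiv i φ (cover L y) = fderiv ℝ (φ ∘ cover L) y (Pi.single i 1) := by
  rw [← (hφ.differentiable y).lineDeriv_eq_fderiv]
  simp only [pderiv, cover_add_single]
  rfl

lemma IsTest.hasDerivAt {φ : Torus L → ℝ} (hφ : IsTest φ) (i : Fin 2) (x : Torus L) :
    HasDerivAt (fun s : ℝ => φ (x + Pi.single i (s : AddCircle L))) (pderiv i φ x) 0 := by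
  obtain ⟨y, rfl⟩ := cover_surjective x
  have := (hφ.differentiable y).lineDifferentiableAt (v := Pi.single i 1)
  simp only [pderiv, cover_add_single]
  exact this.hasDerivAt

lemma IsTest.pderiv {φ : Torus L → ℝ} (hφ : IsTest φ) (i : Fin 2) : IsTest (pderiv i φ) := by
  have h : (fun y : Fin 2 → ℝ => TQG.pderiv i φ (cover L y)) =
      fun y => fderiv ℝ (φ ∘ cover L) y (Pi.single i 1) := funext fun y => hφ.pderiv_cover i y
  change ContDiff ℝ _ (fun y : Fin 2 → ℝ => TQG.pderiv i φ (cover L y))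
  rw [h]
  exact (ContDiff.fderiv_right (m := (⊤ : ℕ∞)) hφ (by simp)).clm_apply contDiff_const

lemma IsTest.continuous {φ : Torus L → ℝ} (hφ : IsTest φ) : Continuous φ :=
  isOpenQuotientMap_cover.isQuotientMap.continuous_iff.2 (ContDiff.continuous hφ)

lemma IsTest.mul {φ χ : Torus L → ℝ} (hφ : IsTest φ) (hχ : IsTest χ) :
    IsTest (fun x => φ x * χ x) := ContDiff.mul hφ hχ

lemma IsTest.pderiv_mul {φ χ : Torus L → ℝ} (hφ : IsTest φ) (hχ : IsTest χ) (i : Fin 2)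
    (x : Torus L) :
    TQG.pderiv i (fun x => φ x * χ x) x = TQG.pderiv i φ x * χ x + φ x * TQG.pderiv i χ x := by
  have := ((hφ.hasDerivAt i x).mul (hχ.hasDerivAt i x)).deriv
  simpa using! this

lemma IsTest.pderiv_comm {φ : Torus L → ℝ} (hφ : IsTest φ) (i j : Fin 2) :
    TQG.pderiv i (TQG.pderiv j φ) = TQG.pderiv j (TQG.pderiv i φ) := by
  have hd : Differentiable ℝ (fderiv ℝ (φ ∘ cover L)) :=
    (ContDiff.fderiv_right (m := 1) hφ (by norm_cast)).differentiable (by simp)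
  have key : ∀ i j y, TQG.pderiv i (TQG.pderiv j φ) (cover L y) =
      fderiv ℝ (fderiv ℝ (φ ∘ cover L)) y (Pi.single i 1) (Pi.single j 1) := by
    intro i j y
    rw [(hφ.pderiv j).pderiv_cover]
    have h : TQG.pderiv j φ ∘ cover L =
        fun y => fderiv ℝ (φ ∘ cover L) y (Pi.single j 1) := funext fun y => hφ.pderiv_cover j y
    rw [h, fderiv_clm_apply (hd y) (differentiableAt_const _)]
    simp
  funext x
  obtain ⟨y, rfl⟩ := cover_surjective x
  rw [key, key]
  have hs : IsSymmSndFDerivAt ℝ (φ ∘ cover L) y :=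
    ContDiffAt.isSymmSndFDerivAt (n := (⊤ : ℕ∞)) (ContDiff.contDiffAt hφ)
      (by simpa using ENat.LEInfty.out)
  exact hs _ _

end

/-! ### Fourier series on the torus -/

section

variable {L : ℝ} [Fact (0 < L)]

open Complex ComplexConjugate Filter Topology

/-- The `L²`-normalised exponential monomials on the torus. -/
def mode (L : ℝ) (k : Fin 2 → ℤ) : C(Torus L, ℂ) where
  toFun x := (L : ℂ)⁻¹ * ∏ i, fourier (k i) (x i)
  continuous_toFun := by fun_prop

lemma mode_apply (k : Fin 2 → ℤ) (x : Torus L) :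
    mode L k x = (L : ℂ)⁻¹ * ∏ i, fourier (k i) (x i) := rfl

lemma norm_mode (k : Fin 2 → ℤ) (x : Torus L) : ‖mode L k x‖ = L⁻¹ := by
  have hL : 0 < L := Fact.out
  simp [mode_apply, abs_of_pos hL, Circle.norm_coe]

/-- The star subalgebra of continuous functions generated by the exponential monomials. -/
def modeSubalgebra (L : ℝ) [Fact (0 < L)] : StarSubalgebra ℂ C(Torus L, ℂ) where
  toSubalgebra := Algebra.adjoin ℂ (Set.range (mode L))
  star_mem' := by
    change Algebra.adjoin ℂ (Set.range (mode L)) ≤ star (Algebra.adjoin ℂ (Set.range (mode L)))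
    refine Algebra.adjoin_le ?_
    rintro _ ⟨n, rfl⟩
    refine Algebra.subset_adjoin ⟨-n, ?_⟩
    ext1 x
    simp only [mode_apply, Pi.neg_apply, fourier_neg, ContinuousMap.star_apply, star_mul',
      star_def, map_inv₀, conj_ofReal, map_prod]

lemma mode_mul_mode (m n : Fin 2 → ℤ) : mode L m * mode L n = (L : ℂ)⁻¹ • mode L (m + n) := by
  ext x
  simp only [ContinuousMap.mul_apply, ContinuousMap.smul_apply, mode_apply, Pi.add_apply,
    fourier_add, Finset.prod_mul_distrib, smul_eq_mul]
  ring

lemma mode_zero_smul : (L : ℂ) • mode L 0 = 1 := by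
  have hL : (L : ℂ) ≠ 0 := by exact_mod_cast (Fact.out : 0 < L).ne'
  ext x
  simp [mode_apply, hL]

lemma modeSubalgebra_coe :
    (modeSubalgebra L).toSubalgebra.toSubmodule = Submodule.span ℂ (Set.range (mode L)) := by
  apply le_antisymm
  · intro f hf
    change f ∈ Algebra.adjoin ℂ (Set.range (mode L)) at hf
    induction hf using Algebra.adjoin_induction with
    | mem x hx => exact Submodule.subset_span hx
    | algebraMap r =>
      rw [Algebra.algebraMap_eq_smul_one, ← mode_zero_smul (L := L)]
      exact Submodule.smul_mem _ _ (Submodule.smul_mem _ _ (Submodule.subset_span ⟨0, rfl⟩))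
    | add x y _ _ hx hy => exact Submodule.add_mem _ hx hy
    | mul x y _ _ hx hy =>
      have := Submodule.mul_mem_mul hx hy
      rw [Submodule.span_mul_span] at this
      refine Submodule.span_le.2 ?_ this
      rintro _ ⟨_, ⟨m, rfl⟩, _, ⟨n, rfl⟩, rfl⟩
      simp only [mode_mul_mode]
      exact Submodule.smul_mem _ _ (Submodule.subset_span ⟨_, rfl⟩)
  · exact Algebra.span_le_adjoin ℂ _

lemma modeSubalgebra_separatesPoints : (modeSubalgebra L).SeparatesPoints := by
  intro x y hxy
  have hL : (L : ℂ) ≠ 0 := by exact_mod_cast (Fact.out : 0 < L).ne'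
  obtain ⟨i, hi⟩ := Function.ne_iff.1 hxy
  refine ⟨_, ⟨mode L (Pi.single i 1), Algebra.subset_adjoin ⟨Pi.single i 1, rfl⟩, rfl⟩, ?_⟩
  have key : ∀ z : Torus L, mode L (Pi.single i 1) z = (L : ℂ)⁻¹ * fourier 1 (z i) := by
    intro z
    rw [mode_apply, Fin.prod_univ_two]
    fin_cases i <;> simp
  change mode L (Pi.single i 1) x ≠ mode L (Pi.single i 1) y
  rw [key, key, fourier_one, fourier_one]
  intro h
  have h' := mul_left_cancel₀ (inv_ne_zero hL) h
  exact hi (AddCircle.injective_toCircle (Fact.out : 0 < L).ne' (Subtype.coe_inj.1 h'))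

lemma span_mode_closure_eq_top :
    (Submodule.span ℂ (Set.range (mode L))).topologicalClosure = ⊤ := by
  rw [← modeSubalgebra_coe]
  exact congr_arg (Subalgebra.toSubmodule <| StarSubalgebra.toSubalgebra ·)
    (ContinuousMap.starSubalgebra_topologicalClosure_eq_top_of_separatesPoints _
      modeSubalgebra_separatesPoints)

/-- The exponential monomials as elements of the complex `L²` space. -/
def modeLp (L : ℝ) [Fact (0 < L)] (k : Fin 2 → ℤ) : Lp ℂ 2 (volume : Measure (Torus L)) :=
  ContinuousMap.toLp 2 volume ℂ (mode L k)

lemma integral_fourier (n : ℤ) :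
    ∫ x : AddCircle L, fourier n x = if n = 0 then (L : ℂ) else 0 := by
  have hL : (0 : ℝ) < L := Fact.out
  have h := orthonormal_iff_ite.1 (orthonormal_fourier (T := L)) 0 n
  rw [ContinuousMap.inner_toLp, AddCircle.integral_haarAddCircle] at h
  simp only [← fourier_neg, ← fourier_add, neg_zero, add_zero] at h
  rw [inv_smul_eq_iff₀ hL.ne'] at h
  rw [h]
  by_cases hn : n = 0
  · simp [hn]
  · simp [hn, Ne.symm hn]

lemma orthonormal_modeLp : Orthonormal ℂ (modeLp L) := by
  have hL : (L : ℂ) ≠ 0 := by exact_mod_cast (Fact.out : 0 < L).ne'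
  rw [orthonormal_iff_ite]
  intro m n
  have h : ∀ x, mode L n x * conj (mode L m x) =
      ((L : ℂ)⁻¹ * (L : ℂ)⁻¹) * ∏ i, fourier (n i - m i) (x i) := by
    intro x
    simp only [mode_apply, sub_eq_add_neg, fourier_add, fourier_neg, map_mul, map_prod,
      Finset.prod_mul_distrib, map_inv₀, conj_ofReal]
    ring
  rw [modeLp, modeLp, ContinuousMap.inner_toLp]
  simp only [h]
  rw [integral_const_mul,
    integral_fintype_prod_volume_eq_prod (fun i (x : AddCircle L) => fourier (n i - m i) x)]
  simp only [integral_fourier, Fin.prod_univ_two, sub_eq_zero]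
  by_cases h0 : n 0 = m 0 <;> by_cases h1 : n 1 = m 1
  · have : m = n := by ext i; fin_cases i <;> simp [h0, h1]
    simp [this]
    field_simp
  all_goals
    have : m ≠ n := by rintro rfl; simp_all
    simp [h0, h1, this]

/-- The Fourier basis of the complex `L²` space of the torus. -/
def modeBasis (L : ℝ) [Fact (0 < L)] :
    HilbertBasis (Fin 2 → ℤ) ℂ (Lp ℂ 2 (volume : Measure (Torus L))) :=
  HilbertBasis.mk orthonormal_modeLp (by
    have := (ContinuousMap.toLp_denseRange ℂ (volume : Measure (Torus L)) ℂ
      (p := 2) (by simp)).topologicalClosure_map_submodule (span_mode_closure_eq_top (L := L))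
    rw [Submodule.map_span, ← Set.range_comp] at this
    exact this.ge)

lemma coe_modeBasis : ⇑(modeBasis L) = modeLp L := HilbertBasis.coe_mk _ _

/-- The inclusion of the real into the complex `L²` space. -/
def toComplex (L : ℝ) [Fact (0 < L)] : L2 L →L[ℝ] Lp ℂ 2 (volume : Measure (Torus L)) :=
  ofRealCLM.compLpL 2 volume

/-- The real part as a map from the complex to the real `L²` space. -/
def reL (L : ℝ) [Fact (0 < L)] : Lp ℂ 2 (volume : Measure (Torus L)) →L[ℝ] L2 L :=
  reCLM.compLpL 2 volume

lemma coeFn_toComplex (v : L2 L) : ∀ᵐ x, toComplex L v x = (v x : ℂ) :=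
  ofRealCLM.coeFn_compLpL v

lemma coeFn_reL (v : Lp ℂ 2 (volume : Measure (Torus L))) : ∀ᵐ x, reL L v x = (v x).re :=
  reCLM.coeFn_compLpL v

lemma reL_toComplex (v : L2 L) : reL L (toComplex L v) = v := by
  apply Lp.ext
  filter_upwards [coeFn_toComplex v, coeFn_reL (toComplex L v)] with x h1 h2
  rw [h2, h1, ofReal_re]

lemma norm_toComplex (v : L2 L) : ‖toComplex L v‖ = ‖v‖ := by
  rw [Lp.norm_def, Lp.norm_def]
  congr 1
  apply eLpNorm_congr_norm_ae
  filter_upwards [coeFn_toComplex v] with x h1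
  rw [h1, norm_real]

lemma inner_reL (w : L2 L) (F : Lp ℂ 2 (volume : Measure (Torus L))) :
    inner ℝ w (reL L F) = (inner ℂ (toComplex L w) F : ℂ).re := by
  rw [L2.inner_def, L2.inner_def, ← RCLike.re_eq_complex_re,
    ← integral_re (L2.integrable_inner (toComplex L w) F)]
  apply integral_congr_ae
  filter_upwards [coeFn_toComplex w, coeFn_reL F] with x h1 h2
  simp [h1, h2, mul_comm]

/-- The Fourier coefficients of a real `L²` function. -/
def coef (v : L2 L) (k : Fin 2 → ℤ) : ℂ := inner ℂ (modeLp L k) (toComplex L v)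

lemma coef_add (v w : L2 L) (k : Fin 2 → ℤ) : coef (v + w) k = coef v k + coef w k := by
  simp [coef, inner_add_right]

lemma coef_sub (v w : L2 L) (k : Fin 2 → ℤ) : coef (v - w) k = coef v k - coef w k := by
  simp [coef, inner_sub_right]

/-- The `L²` class of a continuous function. -/
def toL2 (φ : C(Torus L, ℝ)) : L2 L := ContinuousMap.toLp 2 volume ℝ φ

lemma coeFn_toL2 (φ : C(Torus L, ℝ)) : toL2 φ =ᵐ[volume] φ :=
  ContinuousMap.coeFn_toLp volume φ

lemma inner_toL2 (v : L2 L) (φ : C(Torus L, ℝ)) : inner ℝ v (toL2 φ) = ∫ x, v x * φ x := by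
  rw [L2.inner_def]
  apply integral_congr_ae
  filter_upwards [coeFn_toL2 φ] with x hx
  simp [hx, mul_comm]

/-- The real trigonometric polynomial with frequencies in `s` and coefficients `a`. -/
def trig (s : Finset (Fin 2 → ℤ)) (a : (Fin 2 → ℤ) → ℂ) : C(Torus L, ℝ) where
  toFun x := (∑ k ∈ s, a k * mode L k x).re
  continuous_toFun := by fun_prop

lemma trig_apply (s : Finset (Fin 2 → ℤ)) (a : (Fin 2 → ℤ) → ℂ) (x : Torus L) :
    trig s a x = (∑ k ∈ s, a k * mode L k x).re := rfl

lemma toL2_trig (s : Finset (Fin 2 → ℤ)) (a : (Fin 2 → ℤ) → ℂ) :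
    toL2 (trig s a) = reL L (∑ k ∈ s, a k • modeLp L k) := by
  have : ∑ k ∈ s, a k • modeLp L k = ContinuousMap.toLp 2 volume ℂ (∑ k ∈ s, a k • mode L k) := by
    simp [modeLp, map_sum, map_smul]
  rw [this]
  apply Lp.ext
  filter_upwards [coeFn_toL2 (L := L) (trig s a),
    coeFn_reL (ContinuousMap.toLp 2 volume ℂ (∑ k ∈ s, a k • mode L k)),
    ContinuousMap.coeFn_toLp (𝕜 := ℂ) (p := 2) (volume : Measure (Torus L))
      (∑ k ∈ s, a k • mode L k)] with x h1 h2 h3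
  rw [h1, h2, h3, trig_apply]
  simp [ContinuousMap.sum_apply]

lemma tendsto_trig_coef (v : L2 L) :
    Tendsto (fun s => toL2 (trig s (coef v))) atTop (𝓝 v) := by
  have h := (modeBasis L).hasSum_repr (toComplex L v)
  have h2 := ((reL L).continuous.tendsto _).comp h
  rw [reL_toComplex, SummationFilter.unconditional_filter] at h2
  convert h2 using 2 with s
  simp [toL2_trig, coef, HilbertBasis.repr_apply_apply, coe_modeBasis]

lemma eq_of_coef_eq {v w : L2 L} (h : ∀ k, coef v k = coef w k) : v = w :=
  tendsto_nhds_unique (tendsto_trig_coef v) (by rw [funext h]; exact tendsto_trig_coef w)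

lemma hasSum_sq_coef (v : L2 L) : HasSum (fun k => ‖coef v k‖ ^ 2) (‖v‖ ^ 2) := by
  have h := (modeBasis L).hasSum_inner_mul_inner (toComplex L v) (toComplex L v)
  have h2 := hasSum_re h
  rw [inner_self_eq_norm_sq_to_K, norm_toComplex] at h2
  convert h2 using 1
  · funext k
    rw [coef, coe_modeBasis, ← inner_conj_symm (toComplex L v), mul_comm, mul_conj,
      normSq_eq_norm_sq]
    norm_cast
  · norm_cast

lemma integral_mul_trig_singleton (w : L2 L) (k : Fin 2 → ℤ) (a : (Fin 2 → ℤ) → ℂ) :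
    ∫ x, w x * trig {k} a x = (a k * conj (coef w k)).re := by
  rw [← inner_toL2, toL2_trig, inner_reL, Finset.sum_singleton, inner_smul_right, coef,
    inner_conj_symm]

end

/-! ### Weak derivatives -/

section

variable {L : ℝ} [Fact (0 < L)]
open Complex ComplexConjugate Filter Topology

/-- The symbol `2πi kᵢ / L` of the `i`-th partial derivative. -/
def freq (L : ℝ) (k : Fin 2 → ℤ) (i : Fin 2) : ℂ := 2 * Real.pi * I * k i / L

/-- The symbol of `∂^β`. -/
def symbol (L : ℝ) (β : ℕ × ℕ) (k : Fin 2 → ℤ) : ℂ := freq L k 0 ^ β.1 * freq L k 1 ^ β.2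

lemma conj_freq (k : Fin 2 → ℤ) (i : Fin 2) : conj (freq L k i) = -freq L k i := by
  have h2 : (starRingEnd ℂ) 2 = 2 := map_ofNat _ 2
  simp [freq, h2]
  ring

lemma conj_symbol (β : ℕ × ℕ) (k : Fin 2 → ℤ) :
    conj (symbol L β k) = (-1) ^ (β.1 + β.2) * symbol L β k := by
  simp only [symbol, map_mul, map_pow, conj_freq]
  rw [neg_pow, neg_pow (freq L k 1), pow_add]
  ring

lemma mode_add_single (k : Fin 2 → ℤ) (x : Torus L) (i : Fin 2) (s : ℝ) :
    mode L k (x + Pi.single i (s : AddCircle L)) = exp (freq L k i * s) * mode L k x := by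
  have h : fourier (k i) (x i + (s : AddCircle L)) =
      exp (freq L k i * s) * fourier (k i) (x i) := by
    have : exp (freq L k i * s) = fourier (k i) (s : AddCircle L) := by
      rw [fourier_coe_apply, freq]; congr 1; ring
    rw [this, fourier_apply, smul_add, AddCircle.toCircle_add, Circle.coe_mul, mul_comm]
    rfl
  rw [mode_apply, mode_apply, Fin.prod_univ_two, Fin.prod_univ_two]
  fin_cases i
  · simp only [Fin.zero_eta, Pi.add_apply, Pi.single_eq_same, ne_eq, one_ne_zero,
      not_false_eq_true, Pi.single_eq_of_ne, add_zero] at h ⊢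
    rw [h]; ring
  · simp only [Fin.mk_one, Pi.add_apply, Pi.single_eq_same, ne_eq, zero_ne_one,
      not_false_eq_true, Pi.single_eq_of_ne, add_zero] at h ⊢
    rw [h]; ring

lemma isTest_trig (s : Finset (Fin 2 → ℤ)) (a : (Fin 2 → ℤ) → ℂ) :
    IsTest (L := L) (trig s a) := by
  have h : (fun y : Fin 2 → ℝ => trig s a (fun i => (y i : AddCircle L))) =
      fun y => reCLM (∑ k ∈ s, a k * ((L : ℂ)⁻¹ *
        ∏ i, exp (2 * Real.pi * I * k i * ofRealCLM (y i) / L))) := by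
    funext y
    simp only [trig_apply, mode_apply, fourier_coe_apply, reCLM_apply, ofRealCLM_apply]
  rw [IsTest, h]
  refine reCLM.contDiff.comp (ContDiff.sum fun k _ => contDiff_const.mul (contDiff_const.mul
    (contDiff_prod fun i _ => ?_)))
  refine ContDiff.cexp (ContDiff.div_const (contDiff_const.mul ?_) _)
  exact ofRealCLM.contDiff.comp (contDiff_apply ℝ ℝ i)

lemma pderiv_trig (i : Fin 2) (s : Finset (Fin 2 → ℤ)) (a : (Fin 2 → ℤ) → ℂ) :
    pderiv (L := L) i (trig s a) = trig s (fun k => freq L k i * a k) := by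
  funext x
  have hexp : ∀ k, HasDerivAt (fun t : ℝ => exp (freq L k i * t)) (freq L k i) 0 := by
    intro k
    have h1 : HasDerivAt (fun t : ℝ => freq L k i * (t : ℂ)) (freq L k i) 0 := by
      simpa using (ofRealCLM.hasDerivAt (x := (0 : ℝ))).const_mul (freq L k i)
    simpa using h1.cexp
  have hsum : HasDerivAt (fun t : ℝ => ∑ k ∈ s, a k * (exp (freq L k i * t) * mode L k x))
      (∑ k ∈ s, a k * (freq L k i * mode L k x)) 0 :=
    HasDerivAt.fun_sum fun k _ => ((hexp k).mul_const _).const_mul _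
  have hre := reCLM.hasFDerivAt.comp_hasDerivAt (0 : ℝ) hsum
  have : (fun t : ℝ => trig s a (x + Pi.single i (t : AddCircle L))) =
      reCLM ∘ fun t : ℝ => ∑ k ∈ s, a k * (exp (freq L k i * t) * mode L k x) := by
    funext t
    simp only [trig_apply, mode_add_single, Function.comp, reCLM_apply]
  rw [pderiv, this, hre.deriv, trig_apply, reCLM_apply]
  congr 1
  exact Finset.sum_congr rfl fun k _ => by ring

lemma iterate_pderiv_trig (i : Fin 2) (n : ℕ) (s : Finset (Fin 2 → ℤ))
    (a : (Fin 2 → ℤ) → ℂ) :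
    (pderiv (L := L) i)^[n] (trig s a) = trig s (fun k => freq L k i ^ n * a k) := by
  induction n with
  | zero => simp
  | succ n ih =>
    rw [Function.iterate_succ_apply', ih, pderiv_trig]
    congr 2
    funext k
    ring

lemma pderivs_trig (β : ℕ × ℕ) (s : Finset (Fin 2 → ℤ)) (a : (Fin 2 → ℤ) → ℂ) :
    pderivs (L := L) β (trig s a) = trig s (fun k => symbol L β k * a k) := by
  rw [pderivs, iterate_pderiv_trig, iterate_pderiv_trig]
  congr 2
  funext k
  rw [symbol]
  ring

lemma HasWeakDeriv.coef_eq {β : ℕ × ℕ} {v w : L2 L} (h : HasWeakDeriv β v w)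
    (k : Fin 2 → ℤ) : coef w k = symbol L β k * coef v k := by
  set z : ℂ := symbol L β k * conj (coef v k) - (-1) ^ (β.1 + β.2) * conj (coef w k) with hz
  have h1 := h _ (isTest_trig {k} (fun _ => conj z))
  rw [pderivs_trig, integral_mul_trig_singleton, integral_mul_trig_singleton] at h1
  have h2 : (conj z * z).re = 0 := by
    have hpow : ((-1 : ℂ) ^ (β.1 + β.2)) = (((-1 : ℝ) ^ (β.1 + β.2) : ℝ) : ℂ) := by
      push_cast; rfl
    have : conj z * z = symbol L β k * conj z * conj (coef v k) -
        (((-1 : ℝ) ^ (β.1 + β.2) : ℝ) : ℂ) * (conj z * conj (coef w k)) := by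
      rw [← hpow]; nth_rewrite 2 [hz]; ring
    rw [this, sub_re, re_ofReal_mul, h1, sub_self]
  have h3 : z = 0 := by
    rw [mul_comm, mul_conj, ofReal_re] at h2
    exact normSq_eq_zero.1 h2
  have h4 : conj z = 0 := by rw [h3, map_zero]
  rw [hz] at h4
  simp only [map_sub, map_mul, conj_symbol, map_pow, map_neg, map_one, conj_conj] at h4
  have h5 : ((-1 : ℂ) ^ (β.1 + β.2)) ≠ 0 := pow_ne_zero _ (by norm_num)
  have h6 : ((-1 : ℂ) ^ (β.1 + β.2)) * coef w k =
      ((-1 : ℂ) ^ (β.1 + β.2)) * (symbol L β k * coef v k) := by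
    linear_combination -h4
  exact mul_left_cancel₀ h5 h6

lemma HasWeakDeriv.pderivs_trig_coef {β : ℕ × ℕ} {v w : L2 L} (h : HasWeakDeriv β v w)
    (s : Finset (Fin 2 → ℤ)) : pderivs β (trig (L := L) s (coef v)) = trig s (coef w) := by
  rw [pderivs_trig, funext h.coef_eq]

lemma HasWeakDeriv.unique {β : ℕ × ℕ} {v w w' : L2 L} (h : HasWeakDeriv β v w)
    (h' : HasWeakDeriv β v w') : w = w' :=
  eq_of_coef_eq fun k => by rw [h.coef_eq, h'.coef_eq]

lemma HasWeakDeriv.weakDeriv_eq {β : ℕ × ℕ} {v w : L2 L} (h : HasWeakDeriv β v w) :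
    weakDeriv β v = w := by
  have hex : ∃ w, HasWeakDeriv β v w := ⟨w, h⟩
  rw [weakDeriv, dif_pos hex]
  exact hex.choose_spec.unique h

lemma MemW.hasWeakDeriv {n : ℕ} {v : L2 L} (h : MemW n v) {β : ℕ × ℕ} (hβ : β.1 + β.2 ≤ n) :
    HasWeakDeriv β v (weakDeriv β v) := by
  obtain ⟨w, hw⟩ := h β hβ
  rwa [hw.weakDeriv_eq]

lemma IsTest.pderivs {φ : Torus L → ℝ} (hφ : IsTest φ) (β : ℕ × ℕ) : IsTest (pderivs β φ) := by
  have key : ∀ (i : Fin 2) (n : ℕ) (χ : Torus L → ℝ), IsTest χ → IsTest ((TQG.pderiv i)^[n] χ) := by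
    intro i n χ hχ
    induction n with
    | zero => exact hχ
    | succ n ih => rw [Function.iterate_succ_apply']; exact ih.pderiv i
  exact key _ _ _ (key _ _ _ hφ)

lemma integral_sub_mul_of_continuous (v w : L2 L) {φ : Torus L → ℝ} (hφ : Continuous φ) :
    ∫ x, (v - w : L2 L) x * φ x = (∫ x, v x * φ x) - ∫ x, w x * φ x := by
  have h := inner_toL2 (v - w) ⟨φ, hφ⟩
  rw [inner_sub_left, inner_toL2, inner_toL2] at h
  exact h.symm

lemma HasWeakDeriv.sub {β : ℕ × ℕ} {v w v' w' : L2 L} (h : HasWeakDeriv β v w)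
    (h' : HasWeakDeriv β v' w') : HasWeakDeriv β (v - v') (w - w') := by
  intro φ hφ
  rw [integral_sub_mul_of_continuous _ _ (hφ.pderivs β).continuous,
    integral_sub_mul_of_continuous _ _ hφ.continuous, h φ hφ, h' φ hφ, mul_sub]

lemma HasWeakDeriv.zero (β : ℕ × ℕ) : HasWeakDeriv (L := L) β 0 0 := by
  intro φ hφ
  have h : ∀ χ : Torus L → ℝ, ∫ x, (0 : L2 L) x * χ x = 0 := by
    intro χ
    simp
  rw [h, h, mul_zero]

lemma HasWeakDeriv.neg {β : ℕ × ℕ} {v w : L2 L} (h : HasWeakDeriv β v w) :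
    HasWeakDeriv β (-v) (-w) := by
  simpa using (HasWeakDeriv.zero β).sub h

lemma hasWeakDeriv_zero_index (v : L2 L) : HasWeakDeriv (0, 0) v v := by
  intro φ _
  simp [TQG.pderivs]

lemma weakDeriv_zero_index (v : L2 L) : weakDeriv (0, 0) v = v :=
  (hasWeakDeriv_zero_index v).weakDeriv_eq

lemma sobolevNorm_zero (n : ℕ) : sobolevNorm n (0 : L2 L) = 0 := by
  simp [sobolevNorm, (HasWeakDeriv.zero (L := L) _).weakDeriv_eq]

lemma MemW.mono {m n : ℕ} (h : m ≤ n) {v : L2 L} (hv : MemW n v) : MemW m v :=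
  fun β hβ => hv β (hβ.trans h)

lemma MemW.sub {n : ℕ} {v w : L2 L} (hv : MemW n v) (hw : MemW n w) : MemW n (v - w) :=
  fun _ hβ => ⟨_, (hv.hasWeakDeriv hβ).sub (hw.hasWeakDeriv hβ)⟩

lemma weakDeriv_sub {n : ℕ} {v w : L2 L} (hv : MemW n v) (hw : MemW n w) {β : ℕ × ℕ}
    (hβ : β.1 + β.2 ≤ n) : weakDeriv β (v - w) = weakDeriv β v - weakDeriv β w :=
  ((hv.hasWeakDeriv hβ).sub (hw.hasWeakDeriv hβ)).weakDeriv_eq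

lemma norm_weakDeriv_le_sobolevNorm {n : ℕ} (v : L2 L) {β : ℕ × ℕ} (hβ : β.1 + β.2 ≤ n) :
    ‖weakDeriv β v‖ ≤ sobolevNorm n v := by
  rw [sobolevNorm]
  refine le_trans ?_ (Finset.single_le_sum
    (f := fun m => ∑ β ∈ Finset.HasAntidiagonal.antidiagonal m, ‖weakDeriv β v‖)
    (fun m _ => Finset.sum_nonneg fun _ _ => norm_nonneg _)
    (Finset.mem_range.2 (Nat.lt_succ_of_le hβ)))
  exact Finset.single_le_sum (f := fun β => ‖weakDeriv β v‖) (fun _ _ => norm_nonneg _)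
    (Finset.HasAntidiagonal.mem_antidiagonal.2 rfl)

lemma ContInW.continuousOn_weakDeriv {n : ℕ} {T : ℝ} {v : ℝ → L2 L} (h : ContInW n T v)
    {β : ℕ × ℕ} (hβ : β.1 + β.2 ≤ n) :
    ContinuousOn (fun t => weakDeriv β (v t)) (Set.Icc 0 T) := by
  intro t ht
  rw [ContinuousWithinAt, tendsto_iff_norm_sub_tendsto_zero]
  refine squeeze_zero' (Eventually.of_forall fun _ => norm_nonneg _) ?_ (h t ht).2
  filter_upwards [self_mem_nhdsWithin] with s hs
  rw [← weakDeriv_sub (h s hs).1 (h t ht).1 hβ]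
  exact norm_weakDeriv_le_sobolevNorm _ hβ

lemma ContInW.continuousOn {n : ℕ} {T : ℝ} {v : ℝ → L2 L} (h : ContInW n T v) :
    ContinuousOn v (Set.Icc 0 T) := by
  simpa [weakDeriv_zero_index] using h.continuousOn_weakDeriv (β := (0, 0)) (Nat.zero_le _)

lemma exists_norm_le_of_continuousOn {T : ℝ} {v : ℝ → L2 L}
    (h : ContinuousOn v (Set.Icc 0 T)) : ∃ M, ∀ t ∈ Set.Icc 0 T, ‖v t‖ ≤ M :=
  isCompact_Icc.exists_bound_of_continuousOn h

/-- The unit multi-indices. -/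
def unitIndex (i : Fin 2) : ℕ × ℕ := ![(1, 0), (0, 1)] i

lemma pderivs_unitIndex (i : Fin 2) (φ : Torus L → ℝ) : pderivs (unitIndex i) φ = pderiv i φ := by
  fin_cases i <;> rfl

lemma unitIndex_sum (i : Fin 2) : (unitIndex i).1 + (unitIndex i).2 = 1 := by
  fin_cases i <;> rfl

lemma unitIndex_add_sum (i j : Fin 2) :
    (unitIndex i + unitIndex j).1 + (unitIndex i + unitIndex j).2 = 2 := by
  fin_cases i <;> fin_cases j <;> rfl

lemma IsTest.pderivs_unitIndex_add {φ : Torus L → ℝ} (hφ : IsTest φ) (i j : Fin 2) :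
    TQG.pderivs (unitIndex i + unitIndex j) φ = TQG.pderiv i (TQG.pderiv j φ) := by
  fin_cases i <;> fin_cases j
  · rfl
  · rfl
  · exact hφ.pderiv_comm 0 1
  · rfl

lemma HasWeakDeriv.of_second {i j : Fin 2} {v w z : L2 L} (hw : HasWeakDeriv (unitIndex i) v w)
    (hz : HasWeakDeriv (unitIndex i + unitIndex j) v z) : HasWeakDeriv (unitIndex j) w z := by
  intro φ hφ
  have h1 := hw _ (hφ.pderiv j)
  have h2 := hz φ hφ
  rw [hφ.pderivs_unitIndex_add, unitIndex_add_sum] at h2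
  rw [pderivs_unitIndex, unitIndex_sum] at h1
  rw [pderivs_unitIndex, unitIndex_sum]
  linarith

end

/-! ### Bounds in the supremum norm -/

section

variable {L : ℝ} [Fact (0 < L)]
open Complex ComplexConjugate Filter Topology

/-- `|a| ≤ M` almost everywhere. -/
def EssBdd (a : L2 L) (M : ℝ) : Prop := ∀ᵐ x, |a x| ≤ M

lemma EssBdd.mono {a : L2 L} {M N : ℝ} (h : EssBdd a M) (hMN : M ≤ N) : EssBdd a N := by
  filter_upwards [h] with x hx using hx.trans hMN

lemma EssBdd.neg {a : L2 L} {M : ℝ} (h : EssBdd a M) : EssBdd (-a) M := by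
  filter_upwards [h, Lp.coeFn_neg a] with x hx h2
  rw [h2, Pi.neg_apply, abs_neg]
  exact hx

lemma EssBdd.sub {a b : L2 L} {M N : ℝ} (h : EssBdd a M) (h' : EssBdd b N) :
    EssBdd (a - b) (M + N) := by
  filter_upwards [h, h', Lp.coeFn_sub a b] with x hx hx' h2
  rw [h2, Pi.sub_apply]
  exact (abs_sub _ _).trans (add_le_add hx hx')

lemma EssBdd.of_sum_norm_coef_le {a : L2 L} {S : ℝ}
    (h : ∀ s : Finset (Fin 2 → ℤ), ∑ k ∈ s, ‖coef a k‖ ≤ S) : EssBdd a (S * L⁻¹) := by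
  have h1 := tendstoInMeasure_of_tendsto_Lp (tendsto_trig_coef a)
  obtain ⟨ns, -, hns⟩ := h1.exists_seq_tendsto_ae'
  have h2 : ∀ᵐ x, ∀ n, toL2 (L := L) (trig (ns n) (coef a)) x =
      trig (ns n) (coef a) x :=
    ae_all_iff.2 fun n => coeFn_toL2 _
  filter_upwards [hns, h2] with x hx hx2
  refine le_of_tendsto hx.abs (Eventually.of_forall fun n => ?_)
  rw [hx2, trig_apply]
  refine (abs_re_le_norm _).trans ((norm_sum_le _ _).trans ?_)
  simp only [norm_mul, norm_mode, ← Finset.sum_mul]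
  have hL : 0 < L := Fact.out
  gcongr
  exact h _

/-- The symbol `1 + |κ|²` of `1 - Δ`. -/
def weight (L : ℝ) (k : Fin 2 → ℤ) : ℝ := 1 + ‖freq L k 0‖ ^ 2 + ‖freq L k 1‖ ^ 2

lemma weight_pos (k : Fin 2 → ℤ) : 0 < weight L k := by unfold weight; positivity

lemma norm_freq_sq (k : Fin 2 → ℤ) (i : Fin 2) :
    ‖freq L k i‖ ^ 2 = (2 * Real.pi / L) ^ 2 * (k i : ℝ) ^ 2 := by
  have hL : 0 < L := Fact.out
  simp [freq, abs_of_pos hL, abs_of_pos Real.pi_pos, mul_pow, div_pow]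
  ring

lemma freq_sq (k : Fin 2 → ℤ) (i : Fin 2) : freq L k i ^ 2 = -((‖freq L k i‖ ^ 2 : ℝ) : ℂ) := by
  rw [norm_freq_sq, freq]
  simp only [mul_pow, div_pow, I_sq]
  push_cast
  ring

lemma summable_inv_weight_sq : Summable fun k : Fin 2 → ℤ => (weight L k)⁻¹ ^ 2 := by
  have hL : 0 < L := Fact.out
  set c : ℝ := (2 * Real.pi / L) ^ 2 with hc
  have hcpos : 0 < c := by positivity
  have h1 : Summable fun n : ℤ => (1 + c * (n : ℝ) ^ 2)⁻¹ := by
    have h2 : Summable fun n : ℤ => c⁻¹ * (1 / (n : ℝ) ^ 2) :=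
      (Real.summable_one_div_int_pow.2 (by norm_num)).mul_left _
    refine h2.of_norm_bounded_eventually ?_
    have : ({0}ᶜ : Set ℤ) ∈ cofinite := (Set.finite_singleton _).compl_mem_cofinite
    filter_upwards [this] with n hn
    have hn' : (n : ℝ) ≠ 0 := by exact_mod_cast hn
    have hn2 : 0 < (n : ℝ) ^ 2 := by positivity
    rw [Real.norm_of_nonneg (by positivity), one_div, ← mul_inv]
    exact inv_anti₀ (by positivity) (by linarith)
  have h3 : Summable fun p : ℤ × ℤ => (1 + c * (p.1 : ℝ) ^ 2)⁻¹ * (1 + c * (p.2 : ℝ) ^ 2)⁻¹ :=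
    h1.mul_of_nonneg h1 (fun _ => by positivity) (fun _ => by positivity)
  have h4 := (finTwoArrowEquiv ℤ).summable_iff.2 h3
  refine Summable.of_nonneg_of_le (fun _ => by positivity) (fun k => ?_) h4
  change _ ≤ (1 + c * (k 0 : ℝ) ^ 2)⁻¹ * (1 + c * (k 1 : ℝ) ^ 2)⁻¹
  rw [← mul_inv, inv_pow]
  refine inv_anti₀ (by positivity) ?_
  rw [weight, norm_freq_sq, norm_freq_sq, ← hc]
  have h0 : 0 ≤ c * (k 0 : ℝ) ^ 2 := by positivity
  have h1 : 0 ≤ c * (k 1 : ℝ) ^ 2 := by positivity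
  nlinarith [mul_nonneg h0 h1]

/-- The constant of the Sobolev embedding `W^{2,2} ⊂ L^∞`. -/
def embConst (L : ℝ) : ℝ := √(∑' k : Fin 2 → ℤ, (weight L k)⁻¹ ^ 2)

lemma sum_inv_weight_mul_norm_coef_le (v : L2 L) (s : Finset (Fin 2 → ℤ)) :
    ∑ k ∈ s, (weight L k)⁻¹ * ‖coef v k‖ ≤ embConst L * ‖v‖ := by
  refine (Real.sum_mul_le_sqrt_mul_sqrt s _ _).trans ?_
  refine mul_le_mul (Real.sqrt_le_sqrt ?_) ?_ (Real.sqrt_nonneg _) (Real.sqrt_nonneg _)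
  · exact summable_inv_weight_sq.sum_le_tsum s fun _ _ => by positivity
  · rw [← Real.sqrt_sq (norm_nonneg v)]
    exact Real.sqrt_le_sqrt (sum_le_hasSum s (fun _ _ => by positivity) (hasSum_sq_coef v))

/-- The Sobolev embedding `W^{2,2} ⊂ L^∞` in terms of Fourier coefficients. -/
lemma EssBdd.of_weight_mul_norm_coef_le {a p q r : L2 L}
    (h : ∀ k, weight L k * ‖coef a k‖ ≤ ‖coef p k‖ + ‖coef q k‖ + ‖coef r k‖) :
    EssBdd a (embConst L * (‖p‖ + ‖q‖ + ‖r‖) * L⁻¹) := by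
  refine EssBdd.of_sum_norm_coef_le fun s => ?_
  calc ∑ k ∈ s, ‖coef a k‖
      ≤ ∑ k ∈ s, ((weight L k)⁻¹ * ‖coef p k‖ + (weight L k)⁻¹ * ‖coef q k‖ +
          (weight L k)⁻¹ * ‖coef r k‖) := by
        refine Finset.sum_le_sum fun k _ => ?_
        rw [← mul_add, ← mul_add, ← div_eq_inv_mul, le_div_iff₀' (weight_pos k)]
        exact h k
    _ ≤ _ := by
        rw [Finset.sum_add_distrib, Finset.sum_add_distrib, mul_add, mul_add]
        gcongr <;> exact sum_inv_weight_mul_norm_coef_le _ _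

lemma EssBdd.of_hasWeakDeriv {a p q : L2 L} (hp : HasWeakDeriv (2, 0) a p)
    (hq : HasWeakDeriv (0, 2) a q) : EssBdd a (embConst L * (‖a‖ + ‖p‖ + ‖q‖) * L⁻¹) := by
  refine EssBdd.of_weight_mul_norm_coef_le fun k => le_of_eq ?_
  rw [hp.coef_eq, hq.coef_eq]
  simp [symbol, weight]
  ring

lemma EssBdd.grad_of_hasWeakDeriv {i : Fin 2} {v a p q : L2 L}
    (ha : HasWeakDeriv (unitIndex i) v a)
    (hp : HasWeakDeriv (unitIndex i + (2, 0)) v p)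
    (hq : HasWeakDeriv (unitIndex i + (0, 2)) v q) :
    EssBdd a (embConst L * (‖a‖ + ‖p‖ + ‖q‖) * L⁻¹) := by
  refine EssBdd.of_weight_mul_norm_coef_le fun k => le_of_eq ?_
  rw [hp.coef_eq, hq.coef_eq, ha.coef_eq]
  simp [symbol, weight, pow_add]
  ring

/-- The elliptic estimate for `(Δ - 1) ψ = g`, in `L^∞`. -/
lemma EssBdd.of_elliptic {ψ g p q z zp zq : L2 L} {β : ℕ × ℕ} (hβ : β.1 + β.2 ≤ 2)
    (hp : HasWeakDeriv (2, 0) ψ p) (hq : HasWeakDeriv (0, 2) ψ q) (hg : g = p + q - ψ)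
    (hz : HasWeakDeriv β ψ z) (hzp : HasWeakDeriv (2, 0) g zp) (hzq : HasWeakDeriv (0, 2) g zq) :
    EssBdd z (embConst L * (‖g‖ + ‖zp‖ + ‖zq‖) * L⁻¹) := by
  refine EssBdd.of_weight_mul_norm_coef_le fun k => ?_
  have h1 : coef g k = -((weight L k : ℝ) : ℂ) * coef ψ k := by
    rw [hg, coef_sub, coef_add, hp.coef_eq, hq.coef_eq]
    simp only [symbol, pow_zero, mul_one, one_mul, freq_sq, weight]
    push_cast
    ring
  have h2 : ‖coef g k‖ = weight L k * ‖coef ψ k‖ := by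
    rw [h1, norm_mul, norm_neg, norm_real, Real.norm_of_nonneg (weight_pos k).le]
  have h3 : ‖coef z k‖ ≤ ‖coef g k‖ := by
    rw [hz.coef_eq, h2, norm_mul]
    gcongr
    obtain ⟨m, n⟩ := β
    simp only [symbol, weight, norm_mul, norm_pow] at hβ ⊢
    generalize ‖freq L k 0‖ = x
    generalize ‖freq L k 1‖ = y
    have hm : m ≤ 2 := by omega
    have hn : n ≤ 2 := by omega
    interval_cases m <;> interval_cases n <;>
      first
      | omega
      | nlinarith [sq_nonneg x, sq_nonneg y, sq_nonneg (x - y), sq_nonneg (x - 1),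
          sq_nonneg (y - 1)]
  have h4 : weight L k * ‖coef g k‖ = ‖coef g k‖ + ‖coef zp k‖ + ‖coef zq k‖ := by
    rw [hzp.coef_eq, hzq.coef_eq]
    simp [symbol, weight]
    ring
  rw [← h4]
  exact mul_le_mul_of_nonneg_left h3 (weight_pos k).le

end

/-! ### Multiplication by bounded functions and integration by parts -/

section

variable {L : ℝ} [Fact (0 < L)]
open Complex ComplexConjugate Filter Topology

lemma EssBdd.memLp_mul {a : L2 L} {M : ℝ} (h : EssBdd a M) (f : L2 L) :
    MemLp (fun x => a x * f x) 2 (volume : Measure (Torus L)) := by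
  refine (Lp.memLp f).of_le_mul (c := M)
    ((Lp.aestronglyMeasurable a).mul (Lp.aestronglyMeasurable f)) ?_
  filter_upwards [h] with x hx
  rw [norm_mul]
  gcongr
  exact hx

open Classical in
/-- Multiplication by an essentially bounded function (zero if it is not bounded). -/
def mulL (a : L2 L) : L2 L →L[ℝ] L2 L :=
  if h : ∃ M, EssBdd a M then
    LinearMap.mkContinuous
      { toFun := fun f => (h.choose_spec.memLp_mul f).toLp
        map_add' := fun f g => by
          rw [← MemLp.toLp_add]
          apply MemLp.toLp_congr
          filter_upwards [Lp.coeFn_add f g] with x hx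
          simp only [hx, Pi.add_apply, mul_add]
        map_smul' := fun c f => by
          rw [← MemLp.toLp_const_smul]
          apply MemLp.toLp_congr
          filter_upwards [Lp.coeFn_smul c f] with x hx
          simp only [hx, Pi.smul_apply, smul_eq_mul, RingHom.id_apply]
          ring }
      h.choose (fun f => by
        apply Lp.norm_le_mul_norm_of_ae_le_mul
        filter_upwards [(h.choose_spec.memLp_mul f).coeFn_toLp, h.choose_spec] with x h1 h2
        simp only [LinearMap.coe_mk, AddHom.coe_mk, h1, norm_mul]
        gcongr
        exact h2)
  else 0

lemma EssBdd.coeFn_mulL {a : L2 L} {M : ℝ} (h : EssBdd a M) (f : L2 L) :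
    ∀ᵐ x, mulL a f x = a x * f x := by
  have h' : ∃ M, EssBdd a M := ⟨M, h⟩
  rw [mulL, dif_pos h']
  exact (h'.choose_spec.memLp_mul f).coeFn_toLp

lemma EssBdd.norm_mulL_le {a : L2 L} {M : ℝ} (h : EssBdd a M) (f : L2 L) :
    ‖mulL a f‖ ≤ M * ‖f‖ := by
  apply Lp.norm_le_mul_norm_of_ae_le_mul
  filter_upwards [h.coeFn_mulL f, h] with x h1 h2
  rw [h1, norm_mul]
  gcongr
  exact h2

lemma EssBdd.inner_mulL {a : L2 L} {M : ℝ} (h : EssBdd a M) (f g : L2 L) :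
    inner ℝ (mulL a f) g = ∫ x, a x * f x * g x := by
  rw [L2.inner_def]
  apply integral_congr_ae
  filter_upwards [h.coeFn_mulL f] with x h1
  simp [h1, mul_comm]

lemma EssBdd.inner_mulL_comm {a : L2 L} {M : ℝ} (h : EssBdd a M) (f g : L2 L) :
    inner ℝ (mulL a f) g = inner ℝ (mulL a g) f := by
  rw [h.inner_mulL, h.inner_mulL]
  exact integral_congr_ae (Eventually.of_forall fun x => by ring)

lemma EssBdd.abs_inner_mulL_le {a : L2 L} {M : ℝ} (h : EssBdd a M) (f g : L2 L) :
    |inner ℝ (mulL a f) g| ≤ M * ‖f‖ * ‖g‖ :=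
  (abs_real_inner_le_norm _ _).trans (by gcongr; exact h.norm_mulL_le f)

lemma EssBdd.mulL_comm {a b : L2 L} {M N : ℝ} (ha : EssBdd a M) (hb : EssBdd b N) :
    mulL a b = mulL b a := by
  apply Lp.ext
  filter_upwards [ha.coeFn_mulL b, hb.coeFn_mulL a] with x h1 h2
  rw [h1, h2, mul_comm]

lemma EssBdd.mulL_sub_left {a b : L2 L} {M N : ℝ} (ha : EssBdd a M) (hb : EssBdd b N)
    (f : L2 L) : mulL (a - b) f = mulL a f - mulL b f := by
  apply Lp.ext
  filter_upwards [ha.coeFn_mulL f, hb.coeFn_mulL f, (ha.sub hb).coeFn_mulL f, Lp.coeFn_sub a b,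
    Lp.coeFn_sub (mulL a f) (mulL b f)] with x h1 h2 h3 h4 h5
  rw [h3, h5, Pi.sub_apply, h1, h2, h4, Pi.sub_apply, sub_mul]

lemma EssBdd.mulL_neg_left {a : L2 L} {M : ℝ} (ha : EssBdd a M) (f : L2 L) :
    mulL (-a) f = -mulL a f := by
  apply Lp.ext
  filter_upwards [ha.coeFn_mulL f, ha.neg.coeFn_mulL f, Lp.coeFn_neg a,
    Lp.coeFn_neg (mulL a f)] with x h1 h2 h3 h4
  rw [h2, h4, Pi.neg_apply, h1, h3, Pi.neg_apply, neg_mul]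

lemma EssBdd.inner_mulL_toL2 {a : L2 L} {M : ℝ} (h : EssBdd a M) (φ χ : C(Torus L, ℝ)) :
    inner ℝ (mulL a (toL2 φ)) (toL2 χ) = inner ℝ a (toL2 (φ * χ)) := by
  rw [h.inner_mulL, inner_toL2]
  apply integral_congr_ae
  filter_upwards [coeFn_toL2 φ, coeFn_toL2 χ] with x h1 h2
  simp [h1, h2, mul_assoc]

/-- Integration by parts against a product, with a bounded coefficient. -/
lemma HasWeakDeriv.inner_mulL_add {i : Fin 2} {v w f f' g g' : L2 L} {M N : ℝ}
    (hv : HasWeakDeriv (unitIndex i) v w) (hvM : EssBdd v M) (hwN : EssBdd w N)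
    (hf : HasWeakDeriv (unitIndex i) f f') (hg : HasWeakDeriv (unitIndex i) g g') :
    inner ℝ (mulL v f') g + inner ℝ (mulL v f) g' = -inner ℝ (mulL w f) g := by
  have tlim : ∀ a p q : L2 L, Tendsto (fun s => inner ℝ (mulL a (toL2 (trig s (coef p))))
      (toL2 (trig s (coef q)))) atTop (𝓝 (inner ℝ (mulL a p) q)) := fun a p q =>
    (((mulL a).continuous.tendsto _).comp (tendsto_trig_coef p)).inner (tendsto_trig_coef q)
  refine tendsto_nhds_unique ((tlim v f' g).add (tlim v f g')) ?_
  refine ((tlim w f g).neg).congr fun s => ?_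
  rw [hwN.inner_mulL_toL2, hvM.inner_mulL_toL2, hvM.inner_mulL_toL2, ← inner_add_right]
  have hF := isTest_trig (L := L) s (coef f)
  have hG := isTest_trig (L := L) s (coef g)
  have h := hv _ (hF.mul hG)
  rw [pderivs_unitIndex, unitIndex_sum, pow_one, neg_one_mul] at h
  have hF' := hf.pderivs_trig_coef s
  have hG' := hg.pderivs_trig_coef s
  rw [pderivs_unitIndex] at hF' hG'
  have e1 : toL2 (trig (L := L) s (coef f') * trig s (coef g)) +
      toL2 (trig s (coef f) * trig s (coef g')) =
      toL2 (trig s (coef f') * trig s (coef g) + trig s (coef f) * trig s (coef g')) := by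
    simp [toL2]
  rw [e1, inner_toL2, inner_toL2]
  refine h.symm.trans ?_
  apply integral_congr_ae
  refine Eventually.of_forall fun x => ?_
  simp only [hF.pderiv_mul hG, hF', hG']
  simp

lemma HasWeakDeriv.inner_comm {i : Fin 2} {f f' g g' : L2 L}
    (hf : HasWeakDeriv (unitIndex i) f f') (hg : HasWeakDeriv (unitIndex i) g g') :
    inner ℝ f' g = -inner ℝ f g' := by
  have h1 : Tendsto (fun s => inner ℝ f' (toL2 (trig s (coef g)))) atTop (𝓝 (inner ℝ f' g)) :=
    tendsto_const_nhds.inner (tendsto_trig_coef g)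
  have h2 : Tendsto (fun s => inner ℝ f (toL2 (trig s (coef g')))) atTop (𝓝 (inner ℝ f g')) :=
    tendsto_const_nhds.inner (tendsto_trig_coef g')
  refine tendsto_nhds_unique h1 (h2.neg.congr fun s => ?_)
  have h := hf _ (isTest_trig (L := L) s (coef g))
  rw [hg.pderivs_trig_coef, unitIndex_sum, pow_one, neg_one_mul] at h
  rw [inner_toL2, inner_toL2, h, neg_neg]

/-- The weak divergence tested against a `W^{1,2}` function. -/
lemma HasWeakDiv.inner_eq {G : Fin 2 → Torus L → ℝ} {F : Fin 2 → L2 L} {g : L2 L}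
    (h : HasWeakDiv G g) (hGF : ∀ i, F i =ᵐ[volume] G i) {v : L2 L} {v' : Fin 2 → L2 L}
    (hv : ∀ i, HasWeakDeriv (unitIndex i) v (v' i)) :
    inner ℝ g v = -∑ i, inner ℝ (F i) (v' i) := by
  have h1 : Tendsto (fun s => inner ℝ g (toL2 (trig s (coef v)))) atTop (𝓝 (inner ℝ g v)) :=
    tendsto_const_nhds.inner (tendsto_trig_coef v)
  have h2 : Tendsto (fun s => ∑ i, inner ℝ (F i) (toL2 (trig s (coef (v' i))))) atTop
      (𝓝 (∑ i, inner ℝ (F i) (v' i))) :=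
    tendsto_finsetSum _ fun i _ => tendsto_const_nhds.inner (tendsto_trig_coef _)
  refine tendsto_nhds_unique h1 (h2.neg.congr fun s => ?_)
  have h3 := h _ (isTest_trig (L := L) s (coef v))
  rw [inner_toL2]
  simp only [inner_toL2]
  rw [eq_neg_iff_add_eq_zero, add_comm, ← eq_neg_iff_add_eq_zero] at h3
  rw [h3, neg_inj, ← integral_finsetSum]
  · apply integral_congr_ae
    filter_upwards [ae_all_iff.2 hGF] with x hx
    refine Finset.sum_congr rfl fun i _ => ?_
    rw [hx i, ← (hv i).pderivs_trig_coef, pderivs_unitIndex]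
  · intro i _
    have := L2.integrable_inner (𝕜 := ℝ) (F i) (toL2 (trig s (coef (v' i))))
    refine this.congr ?_
    filter_upwards [coeFn_toL2 (L := L) (trig s (coef (v' i)))] with x hx
    simp [hx, mul_comm]

end

/-! ### Stream functions and flux estimates -/

section

variable {L : ℝ} [Fact (0 < L)]
open Filter Topology

/-- The weak partial derivative `∂ᵢ v`. -/
def grad (v : L2 L) (i : Fin 2) : L2 L := weakDeriv (unitIndex i) v

/-- The weak second derivative `∂ᵢ ∂ⱼ v`. -/
def hess (v : L2 L) (i j : Fin 2) : L2 L := weakDeriv (unitIndex i + unitIndex j) v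

lemma hess_comm (v : L2 L) (i j : Fin 2) : hess v i j = hess v j i := by
  rw [hess, hess, add_comm]

lemma MemW.hasWeakDeriv_grad {n : ℕ} {v : L2 L} (h : MemW (n + 1) v) (i : Fin 2) :
    HasWeakDeriv (unitIndex i) v (grad v i) :=
  h.hasWeakDeriv (by rw [unitIndex_sum]; omega)

lemma MemW.hasWeakDeriv_hess {v : L2 L} (h : MemW 2 v) (i j : Fin 2) :
    HasWeakDeriv (unitIndex j) (grad v i) (hess v i j) :=
  (h.hasWeakDeriv_grad i).of_second (h.hasWeakDeriv (by rw [unitIndex_add_sum]))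

lemma grad_sub {n : ℕ} {v w : L2 L} (hv : MemW (n + 1) v) (hw : MemW (n + 1) w) (i : Fin 2) :
    grad (v - w) i = grad v i - grad w i :=
  weakDeriv_sub hv hw (by rw [unitIndex_sum]; omega)

/-- The operator `Δ - 1`. -/
def helmholtz (ψ : L2 L) : L2 L := hess ψ 0 0 + hess ψ 1 1 - ψ

lemma helmholtz_sub {ψ χ : L2 L} (hψ : MemW 2 ψ) (hχ : MemW 2 χ) :
    helmholtz (ψ - χ) = helmholtz ψ - helmholtz χ := by
  simp only [helmholtz, hess]
  rw [weakDeriv_sub hψ hχ (by rw [unitIndex_add_sum]),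
    weakDeriv_sub hψ hχ (by rw [unitIndex_add_sum])]
  abel

lemma inner_helmholtz {ψ χ : L2 L} (hψ : MemW 2 ψ) (hχ : MemW 2 χ) :
    inner ℝ (helmholtz ψ) χ = -(inner ℝ ψ χ + ∑ i, inner ℝ (grad ψ i) (grad χ i)) := by
  rw [helmholtz, inner_sub_left, inner_add_left, Fin.sum_univ_two,
    (hψ.hasWeakDeriv_hess 0 0).inner_comm (hχ.hasWeakDeriv_grad 0),
    (hψ.hasWeakDeriv_hess 1 1).inner_comm (hχ.hasWeakDeriv_grad 1)]
  ring

/-- The squared `W^{1,2}` energy `‖ψ‖² + ‖∇ψ‖²`. -/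
def energy (ψ : L2 L) : ℝ := ‖ψ‖ ^ 2 + ∑ i, ‖grad ψ i‖ ^ 2

lemma energy_eq {ψ : L2 L} (hψ : MemW 2 ψ) : energy ψ = -inner ℝ (helmholtz ψ) ψ := by
  rw [inner_helmholtz hψ hψ, neg_neg, energy]
  simp only [real_inner_self_eq_norm_sq]

lemma inner_helmholtz_comm {ψ χ : L2 L} (hψ : MemW 2 ψ) (hχ : MemW 2 χ) :
    inner ℝ (helmholtz ψ) χ = inner ℝ (helmholtz χ) ψ := by
  rw [inner_helmholtz hψ hχ, inner_helmholtz hχ hψ, real_inner_comm]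
  simp only [real_inner_comm]

lemma norm_grad_sq_le_energy (ψ : L2 L) (i : Fin 2) : ‖grad ψ i‖ ^ 2 ≤ energy ψ := by
  have : ‖grad ψ i‖ ^ 2 ≤ ∑ i, ‖grad ψ i‖ ^ 2 :=
    Finset.single_le_sum (f := fun i => ‖grad ψ i‖ ^ 2) (fun _ _ => by positivity)
      (Finset.mem_univ i)
  unfold energy
  nlinarith [sq_nonneg ‖ψ‖]

lemma energy_le {ψ : L2 L} (hψ : MemW 2 ψ) : energy ψ ≤ ‖helmholtz ψ‖ ^ 2 := by
  have h1 : ‖ψ‖ ^ 2 ≤ energy ψ := by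
    unfold energy
    have : 0 ≤ ∑ i, ‖grad ψ i‖ ^ 2 := Finset.sum_nonneg fun _ _ => by positivity
    linarith
  have h2 : energy ψ ≤ ‖helmholtz ψ‖ * ‖ψ‖ := by
    rw [energy_eq hψ, ← inner_neg_left]
    exact (real_inner_le_norm _ _).trans (by rw [norm_neg])
  nlinarith [sq_nonneg (‖helmholtz ψ‖ - ‖ψ‖), norm_nonneg ψ, norm_nonneg (helmholtz ψ)]

lemma norm_le_norm_helmholtz {ψ : L2 L} (hψ : MemW 2 ψ) : ‖ψ‖ ≤ ‖helmholtz ψ‖ := by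
  refine (abs_le_of_sq_le_sq' (le_trans ?_ (energy_le hψ)) (norm_nonneg _)).2
  have : 0 ≤ ∑ i, ‖grad ψ i‖ ^ 2 := Finset.sum_nonneg fun _ _ => by positivity
  unfold energy
  linarith

lemma norm_grad_le {ψ : L2 L} (hψ : MemW 2 ψ) (i : Fin 2) : ‖grad ψ i‖ ≤ ‖helmholtz ψ‖ :=
  abs_le_of_sq_le_sq' ((norm_grad_sq_le_energy ψ i).trans (energy_le hψ)) (norm_nonneg _) |>.2

/-- The velocity `∇^⊥ ψ`. -/
def vel (ψ : L2 L) : Fin 2 → L2 L := ![-grad ψ 1, grad ψ 0]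

/-- The gradient `∂ᵢ (∇^⊥ ψ)ⱼ` of the velocity. -/
def velGrad (ψ : L2 L) (i : Fin 2) : Fin 2 → L2 L := ![-hess ψ 1 i, hess ψ 0 i]

lemma MemW.hasWeakDeriv_vel {ψ : L2 L} (h : MemW 2 ψ) (i j : Fin 2) :
    HasWeakDeriv (unitIndex i) (vel ψ j) (velGrad ψ i j) := by
  fin_cases j
  · exact (h.hasWeakDeriv_hess 1 i).neg
  · exact h.hasWeakDeriv_hess 0 i

lemma vel_sub {ψ χ : L2 L} (hψ : MemW 2 ψ) (hχ : MemW 2 χ) (j : Fin 2) :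
    vel (ψ - χ) j = vel ψ j - vel χ j := by
  fin_cases j
  · simp [vel, grad_sub hψ hχ]; abel
  · simp [vel, grad_sub hψ hχ]

/-- A stream function with two bounded derivatives. -/
structure IsRegular (ψ : L2 L) (M : ℝ) : Prop where
  memW : MemW 2 ψ
  bdd : ∀ β : ℕ × ℕ, β.1 + β.2 ≤ 2 → EssBdd (weakDeriv β ψ) M

namespace IsRegular

variable {ψ ψ₁ ψ₂ : L2 L} {M : ℝ}

lemma essBdd_vel (h : IsRegular ψ M) (j : Fin 2) : EssBdd (vel ψ j) M := by
  fin_cases j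
  · exact (h.bdd _ (by rw [unitIndex_sum]; omega)).neg
  · exact h.bdd _ (by rw [unitIndex_sum]; omega)

lemma essBdd_velGrad (h : IsRegular ψ M) (i j : Fin 2) : EssBdd (velGrad ψ i j) M := by
  fin_cases j
  · exact (h.bdd _ (by rw [unitIndex_add_sum])).neg
  · exact h.bdd _ (by rw [unitIndex_add_sum])

lemma sub (h₁ : IsRegular ψ₁ M) (h₂ : IsRegular ψ₂ M) : IsRegular (ψ₁ - ψ₂) (M + M) where
  memW := h₁.memW.sub h₂.memW
  bdd β hβ := by
    rw [weakDeriv_sub h₁.memW h₂.memW hβ]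
    exact (h₁.bdd β hβ).sub (h₂.bdd β hβ)

/-- The transport operator of a velocity `∇^⊥ ψ` is skew-adjoint. -/
lemma sum_inner_vel (h : IsRegular ψ M) {f g : L2 L} {df dg : Fin 2 → L2 L}
    (hf : ∀ j, HasWeakDeriv (unitIndex j) f (df j))
    (hg : ∀ j, HasWeakDeriv (unitIndex j) g (dg j)) :
    ∑ j, inner ℝ (mulL (vel ψ j) f) (dg j) = -∑ j, inner ℝ (mulL (vel ψ j) (df j)) g := by
  have e : ∀ j, inner ℝ (mulL (vel ψ j) (df j)) g + inner ℝ (mulL (vel ψ j) f) (dg j) =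
      -inner ℝ (mulL (velGrad ψ j j) f) g := fun j =>
    (h.memW.hasWeakDeriv_vel j j).inner_mulL_add (h.essBdd_vel j) (h.essBdd_velGrad j j)
      (hf j) (hg j)
  have e0 := e 0
  have e1 := e 1
  have : mulL (velGrad ψ 0 0) f = -mulL (velGrad ψ 1 1) f := by
    rw [← (h.essBdd_velGrad 1 1).mulL_neg_left]
    simp [velGrad, hess_comm ψ 1 0]
  rw [this, inner_neg_left] at e0
  rw [Fin.sum_univ_two, Fin.sum_univ_two]
  linarith

lemma sum_inner_vel_self (h : IsRegular ψ M) {f : L2 L} {df : Fin 2 → L2 L}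
    (hf : ∀ j, HasWeakDeriv (unitIndex j) f (df j)) :
    ∑ j, inner ℝ (mulL (vel ψ j) f) (df j) = 0 := by
  have h1 := h.sum_inner_vel hf hf
  have h2 : ∑ j, inner ℝ (mulL (vel ψ j) (df j)) f = ∑ j, inner ℝ (mulL (vel ψ j) f) (df j) :=
    Finset.sum_congr rfl fun j _ => (h.essBdd_vel j).inner_mulL_comm _ _
  linarith

/-- The commutator identity for `(Δ - 1) χ` transported by `∇^⊥ ψ` and tested with `∇χ`. -/
lemma sum_inner_vel_helmholtz (h : IsRegular ψ M) {χ : L2 L} (hχ : MemW 2 χ) :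
    ∑ j, inner ℝ (mulL (vel ψ j) (helmholtz χ)) (grad χ j) =
      -∑ i, ∑ j, inner ℝ (mulL (velGrad ψ i j) (grad χ i)) (grad χ j) := by
  have e : ∀ i j, inner ℝ (mulL (vel ψ j) (hess χ i i)) (grad χ j) +
      inner ℝ (mulL (vel ψ j) (grad χ i)) (hess χ j i) =
      -inner ℝ (mulL (velGrad ψ i j) (grad χ i)) (grad χ j) := fun i j =>
    (h.memW.hasWeakDeriv_vel i j).inner_mulL_add (h.essBdd_vel j) (h.essBdd_velGrad i j)
      (hχ.hasWeakDeriv_hess i i) (hχ.hasWeakDeriv_hess j i)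
  have z : ∀ i, ∑ j, inner ℝ (mulL (vel ψ j) (grad χ i)) (hess χ i j) = 0 := fun i =>
    h.sum_inner_vel_self fun j => hχ.hasWeakDeriv_hess i j
  have z' := h.sum_inner_vel_self fun j => hχ.hasWeakDeriv_grad j
  have z0 := z 0
  have z1 := z 1
  have e00 := e 0 0
  have e01 := e 0 1
  have e10 := e 1 0
  have e11 := e 1 1
  simp only [Fin.sum_univ_two, helmholtz, map_sub, map_add, inner_sub_left, inner_add_left] at *
  rw [hess_comm χ 1 0] at *
  linarith

lemma sum_inner_vel_orthogonal (h : IsRegular ψ M) (g : L2 L) :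
    ∑ j, inner ℝ (mulL (vel ψ j) g) (grad ψ j) = 0 := by
  have hb : ∀ j, EssBdd (grad ψ j) M := fun j => h.bdd _ (by rw [unitIndex_sum]; omega)
  rw [Fin.sum_univ_two]
  simp only [vel, Matrix.cons_val_zero, Matrix.cons_val_one]
  rw [(hb 1).mulL_neg_left, inner_neg_left, (hb 1).inner_mulL_comm, (hb 0).inner_mulL_comm,
    (hb 0).mulL_comm (hb 1)]
  ring

lemma norm_vel_sum (ψ : L2 L) : ∑ j, ‖vel ψ j‖ = ‖grad ψ 0‖ + ‖grad ψ 1‖ := by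
  simp [vel, Fin.sum_univ_two, add_comm]

/-- The estimate of the buoyancy flux difference. -/
lemma abs_sum_inner_buoyancy_le (h₁ : IsRegular ψ₁ M) (h₂ : IsRegular ψ₂ M) {b₁ b₂ : L2 L}
    (hb₁ : MemW 1 b₁) (hb₂ : MemW 1 b₂) (hb : ∀ i, EssBdd (grad b₂ i) M) :
    |∑ i, inner ℝ (mulL (vel ψ₁ i) b₁ - mulL (vel ψ₂ i) b₂) (grad (b₁ - b₂) i)| ≤
      M * (‖grad (ψ₁ - ψ₂) 0‖ + ‖grad (ψ₁ - ψ₂) 1‖) * ‖b₁ - b₂‖ := by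
  have hB : ∀ j, HasWeakDeriv (unitIndex j) (b₁ - b₂) (grad (b₁ - b₂) j) := fun j =>
    (hb₁.sub hb₂).hasWeakDeriv_grad j
  have hr := h₁.sub h₂
  have e : ∀ i, mulL (vel ψ₁ i) b₁ - mulL (vel ψ₂ i) b₂ =
      mulL (vel ψ₁ i) (b₁ - b₂) + mulL (vel (ψ₁ - ψ₂) i) b₂ := by
    intro i
    rw [vel_sub h₁.memW h₂.memW, (h₁.essBdd_vel i).mulL_sub_left (h₂.essBdd_vel i), map_sub]
    abel
  simp only [e, inner_add_left, Finset.sum_add_distrib]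
  rw [h₁.sum_inner_vel_self hB, zero_add,
    hr.sum_inner_vel (fun j => hb₂.hasWeakDeriv_grad j) hB, abs_neg,
    ← norm_vel_sum, Finset.mul_sum, Finset.sum_mul]
  refine (Finset.abs_sum_le_sum_abs _ _).trans (Finset.sum_le_sum fun j _ => ?_)
  rw [(hr.essBdd_vel j).mulL_comm (hb j)]
  exact (hb j).abs_inner_mulL_le _ _

/-- The estimate of the vorticity flux difference. -/
lemma abs_sum_inner_vorticity_le (h₁ : IsRegular ψ₁ M) (h₂ : IsRegular ψ₂ M)
    {b₁ b₂ ω₁ ω₂ : L2 L} {uh : Fin 2 → L2 L} (huh : ∀ i, EssBdd (uh i) M)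
    (hω : ω₁ - ω₂ = helmholtz (ψ₁ - ψ₂)) :
    |∑ i, inner ℝ (mulL (vel ψ₁ i) (ω₁ - b₁) - mulL (vel ψ₂ i) (ω₂ - b₂) +
        (mulL (uh i) b₁ - mulL (uh i) b₂)) (grad (ψ₁ - ψ₂) i)| ≤
      M * (‖grad (ψ₁ - ψ₂) 0‖ + ‖grad (ψ₁ - ψ₂) 1‖) ^ 2 +
        2 * (M * (‖grad (ψ₁ - ψ₂) 0‖ + ‖grad (ψ₁ - ψ₂) 1‖) * ‖b₁ - b₂‖) := by
  have hr := h₁.sub h₂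
  have e : ∀ i, mulL (vel ψ₁ i) (ω₁ - b₁) - mulL (vel ψ₂ i) (ω₂ - b₂) +
      (mulL (uh i) b₁ - mulL (uh i) b₂) =
      mulL (vel ψ₁ i) (helmholtz (ψ₁ - ψ₂)) - mulL (vel ψ₁ i) (b₁ - b₂) +
        mulL (vel (ψ₁ - ψ₂) i) (ω₂ - b₂) + mulL (uh i) (b₁ - b₂) := by
    intro i
    rw [vel_sub h₁.memW h₂.memW, (h₁.essBdd_vel i).mulL_sub_left (h₂.essBdd_vel i), ← hω]
    simp only [map_sub]
    abel
  simp only [e, inner_add_left, inner_sub_left, Finset.sum_add_distrib, Finset.sum_sub_distrib]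
  rw [h₁.sum_inner_vel_helmholtz hr.memW, hr.sum_inner_vel_orthogonal, add_zero]
  have k1 : |∑ i, ∑ j, inner ℝ (mulL (velGrad ψ₁ i j) (grad (ψ₁ - ψ₂) i)) (grad (ψ₁ - ψ₂) j)| ≤
      M * (‖grad (ψ₁ - ψ₂) 0‖ + ‖grad (ψ₁ - ψ₂) 1‖) ^ 2 := by
    refine (Finset.abs_sum_le_sum_abs _ _).trans ?_
    refine (Finset.sum_le_sum fun i _ => (Finset.abs_sum_le_sum_abs _ _).trans
      (Finset.sum_le_sum fun j _ => (h₁.essBdd_velGrad i j).abs_inner_mulL_le _ _)).trans ?_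
    simp only [Fin.sum_univ_two]
    exact le_of_eq (by ring)
  have k2 : ∀ a : Fin 2 → L2 L, (∀ i, EssBdd (a i) M) →
      |∑ i, inner ℝ (mulL (a i) (b₁ - b₂)) (grad (ψ₁ - ψ₂) i)| ≤
        M * (‖grad (ψ₁ - ψ₂) 0‖ + ‖grad (ψ₁ - ψ₂) 1‖) * ‖b₁ - b₂‖ := by
    intro a ha
    refine (Finset.abs_sum_le_sum_abs _ _).trans ?_
    refine (Finset.sum_le_sum fun i _ => (ha i).abs_inner_mulL_le _ _).trans ?_
    simp only [Fin.sum_univ_two]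
    exact le_of_eq (by ring)
  have k3 := k2 _ h₁.essBdd_vel
  have k4 := k2 _ huh
  rw [abs_le] at *
  constructor <;> linarith [k1.1, k1.2, k3.1, k3.2, k4.1, k4.2]

end IsRegular

end

/-! ### Gronwall lemma and bounds for solutions -/

section

variable {L : ℝ} [Fact (0 < L)]
open Filter Topology

/-- A Gronwall lemma for a function whose increments are controlled, up to an error that vanishes
on the diagonal, by the integral of a multiple of the function. -/
lemma nonpos_of_increment_le {Z : Type*} [NormedAddCommGroup Z] {E : ℝ → ℝ} {Y : ℝ → Z}
    {K C T : ℝ} (hC : 0 ≤ C) (hE : ContinuousOn E (Set.Icc 0 T))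
    (hY : ContinuousOn Y (Set.Icc 0 T)) (h0 : E 0 ≤ 0)
    (hinc : ∀ s ∈ Set.Icc 0 T, ∀ t ∈ Set.Icc 0 T, s ≤ t → ∃ g : ℝ → ℝ,
      IntervalIntegrable g volume s t ∧ E t - E s ≤ ∫ τ in s..t, g τ ∧
      ∀ τ ∈ Set.Icc s t, g τ ≤ K * E τ + C * (‖Y t - Y τ‖ + ‖Y s - Y τ‖)) :
    ∀ t ∈ Set.Icc 0 T, E t ≤ 0 := by
  intro t ht
  have := le_gronwallBound_of_liminf_deriv_right_le (f := E) (f' := fun s => K * E s) (δ := 0)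
    (K := K) (ε := 0) hE ?_ h0 (fun s _ => by simp) t ht
  · simpa [gronwallBound_ε0_δ0] using this
  intro s hs r hr
  refine Eventually.frequently ?_
  obtain ⟨η, hη, hηr⟩ : ∃ η : ℝ, 0 < η ∧ K * E s + η * (1 + 3 * C) < r := by
    refine ⟨(r - K * E s) / (2 * (1 + 3 * C)), by apply div_pos <;> linarith, ?_⟩
    have : (r - K * E s) / (2 * (1 + 3 * C)) * (1 + 3 * C) = (r - K * E s) / 2 := by
      field_simp
    rw [this]
    linarith
  have hsT : s ∈ Set.Icc 0 T := ⟨hs.1, hs.2.le⟩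
  have hsub : 𝓝[Set.Ici s] s ≤ 𝓝[Set.Icc 0 T] s := by
    refine nhdsWithin_le_of_mem ?_
    filter_upwards [Ico_mem_nhdsGE hs.2] with x hx
    exact ⟨hs.1.trans hx.1, hx.2.le⟩
  have c1 : ∀ᶠ τ in 𝓝[Set.Ici s] s, K * E τ < K * E s + η :=
    (((hE s hsT).const_mul K).mono_left hsub).eventually_lt_const (by linarith)
  have c2 : ∀ᶠ τ in 𝓝[Set.Ici s] s, ‖Y s - Y τ‖ < η := by
    have h1 : Tendsto (fun τ => ‖Y s - Y τ‖) (𝓝[Set.Ici s] s) (𝓝 ‖Y s - Y s‖) :=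
      (tendsto_const_nhds.sub ((hY s hsT).mono_left hsub)).norm
    exact h1.eventually_lt_const (by simpa using hη)
  obtain ⟨u, hu, hsu⟩ := mem_nhdsGE_iff_exists_Ico_subset.1 (c1.and c2)
  filter_upwards [Ioo_mem_nhdsGT (lt_min hu hs.2)] with z hz
  have hzu : z < u := hz.2.trans_le (min_le_left _ _)
  have hzT : z ∈ Set.Icc 0 T := ⟨hs.1.trans hz.1.le, (hz.2.trans_le (min_le_right _ _)).le⟩
  obtain ⟨g, hg, hgE, hgle⟩ := hinc s hsT z hzT hz.1.le
  have hzz := hsu ⟨hz.1.le, hzu⟩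
  have hint : ∫ τ in s..z, g τ ≤ (z - s) * (K * E s + η * (1 + 3 * C)) := by
    rw [← smul_eq_mul, ← intervalIntegral.integral_const]
    refine intervalIntegral.integral_mono_on hz.1.le hg intervalIntegrable_const fun τ hτ => ?_
    obtain ⟨hτ1, hτ2⟩ := hsu (⟨hτ.1, hτ.2.trans_lt hzu⟩ : τ ∈ Set.Ico s u)
    have h3 : ‖Y z - Y τ‖ ≤ 2 * η := by
      have e : Y z - Y τ = (Y s - Y τ) - (Y s - Y z) := by abel
      rw [e]
      exact (norm_sub_le _ _).trans (by linarith [hzz.2])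
    have h4 : C * (‖Y z - Y τ‖ + ‖Y s - Y τ‖) ≤ C * (2 * η + η) := by gcongr
    linarith [hgle τ hτ]
  have hzs : 0 < z - s := sub_pos.2 hz.1
  rw [inv_mul_lt_iff₀ hzs]
  exact (hgE.trans hint).trans_lt (by gcongr)

lemma inner_increment {H : Type*} [NormedAddCommGroup H] [InnerProductSpace ℝ H] [CompleteSpace H]
    {x y x' y' : H} {p : ℝ → H} {s t : ℝ} (hp : IntervalIntegrable p volume s t)
    (hx : x' - x = -∫ τ in s..t, p τ) (hsymm : inner ℝ x' y = inner ℝ x y') :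
    inner ℝ x' y' - inner ℝ x y = ∫ τ in s..t, -inner ℝ (p τ) (y' + y) := by
  have h1 : inner ℝ x' y' - inner ℝ x y = inner ℝ (x' - x) (y' + y) := by
    rw [inner_sub_left, inner_add_right, inner_add_right, hsymm]
    ring
  have h2 := ((innerSL ℝ) (y' + y)).intervalIntegral_comp_comm hp
  simp only [innerSL_apply_apply] at h2
  rw [h1, hx, inner_neg_left, intervalIntegral.integral_neg, real_inner_comm, ← h2]
  simp only [real_inner_comm]

lemma ContInW.exists_isRegular {T : ℝ} {ω : ℝ → L2 L} {f : L2 L} (hω : ContInW 2 T ω)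
    (hf : MemW 2 f) : ∃ M, ∀ t ∈ Set.Icc 0 T, ∀ ψ, MemW 2 ψ → helmholtz ψ = ω t - f →
      IsRegular ψ M := by
  have hbd : ∀ β : ℕ × ℕ, β.1 + β.2 ≤ 2 →
      ∃ M, ∀ t ∈ Set.Icc 0 T, ‖weakDeriv β (ω t - f)‖ ≤ M := by
    intro β hβ
    have hc : ContinuousOn (fun t => weakDeriv β (ω t) - weakDeriv β f) (Set.Icc 0 T) :=
      (hω.continuousOn_weakDeriv hβ).sub continuousOn_const
    obtain ⟨M, hM⟩ := exists_norm_le_of_continuousOn hc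
    exact ⟨M, fun t ht => by rw [weakDeriv_sub (hω t ht).1 hf hβ]; exact hM t ht⟩
  obtain ⟨M₀, h₀⟩ := hbd (0, 0) (by norm_num)
  obtain ⟨M₁, h₁⟩ := hbd (2, 0) (by norm_num)
  obtain ⟨M₂, h₂⟩ := hbd (0, 2) (by norm_num)
  have hL : 0 < L := Fact.out
  refine ⟨embConst L * (M₀ + M₁ + M₂) * L⁻¹, fun t ht ψ hψ hh => ⟨hψ, fun β hβ => ?_⟩⟩
  have hg : MemW 2 (ω t - f) := (hω t ht).1.sub hf
  refine (EssBdd.of_elliptic hβ (hψ.hasWeakDeriv (β := (2, 0)) (by norm_num))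
    (hψ.hasWeakDeriv (β := (0, 2)) (by norm_num)) hh.symm (hψ.hasWeakDeriv hβ)
    (hg.hasWeakDeriv (by norm_num)) (hg.hasWeakDeriv (by norm_num))).mono ?_
  have h0 := h₀ t ht
  rw [weakDeriv_zero_index] at h0
  have : 0 ≤ embConst L := Real.sqrt_nonneg _
  gcongr
  · exact h₁ t ht
  · exact h₂ t ht

lemma unitIndex_add_le (i : Fin 2) {β : ℕ × ℕ} (hβ : β.1 + β.2 ≤ 2) :
    (unitIndex i + β).1 + (unitIndex i + β).2 ≤ 3 := by
  have := unitIndex_sum i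
  simp only [Prod.fst_add, Prod.snd_add]
  omega

lemma ContInW.exists_essBdd_grad {T : ℝ} {b : ℝ → L2 L} (hb : ContInW 3 T b) (i : Fin 2) :
    ∃ M, ∀ t ∈ Set.Icc 0 T, EssBdd (grad (b t) i) M := by
  have h0 : (unitIndex i).1 + (unitIndex i).2 ≤ 3 := by rw [unitIndex_sum]; norm_num
  have h1 := unitIndex_add_le i (β := (2, 0)) (by norm_num)
  have h2 := unitIndex_add_le i (β := (0, 2)) (by norm_num)
  obtain ⟨M₀, hM₀⟩ := exists_norm_le_of_continuousOn (hb.continuousOn_weakDeriv h0)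
  obtain ⟨M₁, hM₁⟩ := exists_norm_le_of_continuousOn (hb.continuousOn_weakDeriv h1)
  obtain ⟨M₂, hM₂⟩ := exists_norm_le_of_continuousOn (hb.continuousOn_weakDeriv h2)
  have hL : 0 < L := Fact.out
  refine ⟨embConst L * (M₀ + M₁ + M₂) * L⁻¹, fun t ht => ?_⟩
  have hbt := (hb t ht).1
  refine (EssBdd.grad_of_hasWeakDeriv (hbt.hasWeakDeriv h0) (hbt.hasWeakDeriv h1)
    (hbt.hasWeakDeriv h2)).mono ?_
  have : 0 ≤ embConst L := Real.sqrt_nonneg _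
  gcongr
  · exact hM₀ t ht
  · exact hM₁ t ht
  · exact hM₂ t ht

lemma MemW.exists_essBdd {v : L2 L} (hv : MemW 2 v) : ∃ M, EssBdd v M :=
  ⟨_, EssBdd.of_hasWeakDeriv (hv.hasWeakDeriv (by norm_num)) (hv.hasWeakDeriv (by norm_num))⟩

/-- A solution with its stream function `ψ`, the divergences `P`, `S` of the fluxes in the two
equations, and uniform bounds. -/
structure IsControlled (uh : Fin 2 → L2 L) (f b₀ ω₀ : L2 L) (T : ℝ) (b ω ψ P S : ℝ → L2 L)
    (M : ℝ) : Prop where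
  b_cont : ContInW 3 T b
  ω_cont : ContInW 2 T ω
  regular : ∀ t ∈ Set.Icc 0 T, IsRegular (ψ t) M
  grad_b : ∀ t ∈ Set.Icc 0 T, ∀ i, EssBdd (grad (b t) i) M
  uh_bdd : ∀ i, EssBdd (uh i) M
  norm_b : ∀ t ∈ Set.Icc 0 T, ‖b t‖ ≤ M
  norm_ω : ∀ t ∈ Set.Icc 0 T, ‖ω t‖ ≤ M
  helm : ∀ t ∈ Set.Icc 0 T, helmholtz (ψ t) = ω t - f
  inner_P : ∀ t ∈ Set.Icc 0 T, ∀ v, MemW 1 v →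
    inner ℝ (P t) v = -∑ i, inner ℝ (mulL (vel (ψ t) i) (b t)) (grad v i)
  inner_S : ∀ t ∈ Set.Icc 0 T, ∀ v, MemW 1 v →
    inner ℝ (S t) v =
      -∑ i, inner ℝ (mulL (vel (ψ t) i) (ω t - b t) + mulL (uh i) (b t)) (grad v i)
  P_int : IntervalIntegrable P volume 0 T
  S_int : IntervalIntegrable S volume 0 T
  b_eq : ∀ t ∈ Set.Icc 0 T, b t = b₀ - ∫ τ in (0 : ℝ)..t, P τ
  ω_eq : ∀ t ∈ Set.Icc 0 T, ω t = ω₀ - ∫ τ in (0 : ℝ)..t, S τ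

lemma IsSolution.exists_isControlled {uh : Fin 2 → L2 L} {f b₀ ω₀ : L2 L} {b ω : ℝ → L2 L}
    {T : ℝ} (hdata : IsData uh f b₀ ω₀) (h : IsSolution uh f b₀ ω₀ b ω T) :
    ∃ (ψ P S : ℝ → L2 L) (M : ℝ), ∀ N, M ≤ N → IsControlled uh f b₀ ω₀ T b ω ψ P S N := by
  obtain ⟨u, P, Q, R, hall, hP, hQ, hR, hb, hω⟩ := h.eqns
  have hstream : ∀ t, ∃ ψ : L2 L, t ∈ Set.Icc 0 T → MemW 2 ψ ∧ helmholtz ψ = ω t - f ∧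
      ∀ i, u t i = vel ψ i := by
    intro t
    by_cases ht : t ∈ Set.Icc 0 T
    · obtain ⟨ψ, hψ, hψω, h0, h1⟩ := (hall t ht).1
      refine ⟨ψ, fun _ => ⟨hψ, ?_, fun i => ?_⟩⟩
      · rw [hψω]
        exact (add_sub_cancel_right _ _).symm
      · fin_cases i
        · exact h0
        · exact h1
    · exact ⟨0, fun h => absurd h ht⟩
  choose ψ hψ using hstream
  obtain ⟨M₁, hM₁⟩ := h.ω_cont.exists_isRegular hdata.f_mem
  choose M₂ hM₂ using h.b_cont.exists_essBdd_grad
  choose M₃ hM₃ using fun i => ((hdata.uh_mem i).mono (by norm_num : 2 ≤ 3)).exists_essBdd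
  obtain ⟨M₄, hM₄⟩ := exists_norm_le_of_continuousOn h.b_cont.continuousOn
  obtain ⟨M₅, hM₅⟩ := exists_norm_le_of_continuousOn h.ω_cont.continuousOn
  refine ⟨ψ, P, fun t => Q t + R t, max (max M₁ (max (max (M₂ 0) (M₂ 1)) (max (M₃ 0) (M₃ 1))))
    (max M₄ M₅), fun N hN => ?_⟩
  simp only [max_le_iff] at hN
  obtain ⟨⟨n1, ⟨n20, n21⟩, n30, n31⟩, n4, n5⟩ := hN
  have hreg : ∀ t ∈ Set.Icc 0 T, IsRegular (ψ t) N := fun t ht =>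
    let hr := hM₁ t ht (ψ t) (hψ t ht).1 (hψ t ht).2.1
    ⟨hr.memW, fun β hβ => (hr.bdd β hβ).mono n1⟩
  have huh : ∀ i, EssBdd (uh i) N := by
    intro i
    refine (hM₃ i).mono ?_
    fin_cases i
    · exact n30
    · exact n31
  refine ⟨h.b_cont, h.ω_cont, hreg, ?_, huh, fun t ht => (hM₄ t ht).trans n4,
    fun t ht => (hM₅ t ht).trans n5, fun t ht => (hψ t ht).2.1, ?_, ?_, hP, hQ.add hR, hb, hω⟩
  · intro t ht i
    refine (hM₂ i t ht).mono ?_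
    fin_cases i
    · exact n20
    · exact n21
  · intro t ht v hv
    refine (hall t ht).2.1.inner_eq (fun i => ?_) (fun i => hv.hasWeakDeriv_grad i)
    filter_upwards [((hreg t ht).essBdd_vel i).coeFn_mulL (b t)] with x hx
    rw [hx, (hψ t ht).2.2, mul_comm]
  · intro t ht v hv
    have e1 := (hall t ht).2.2.1.inner_eq (F := fun i => mulL (vel (ψ t) i) (ω t - b t))
      (fun i => by
        filter_upwards [((hreg t ht).essBdd_vel i).coeFn_mulL (ω t - b t),
          Lp.coeFn_sub (ω t) (b t)] with x hx hx'
        rw [hx, (hψ t ht).2.2, hx', Pi.sub_apply, mul_comm]) (fun i => hv.hasWeakDeriv_grad i)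
    have e2 := (hall t ht).2.2.2.inner_eq (F := fun i => mulL (uh i) (b t))
      (fun i => by
        filter_upwards [(huh i).coeFn_mulL (b t)] with x hx
        rw [hx, mul_comm]) (fun i => hv.hasWeakDeriv_grad i)
    simp only [inner_add_left, Finset.sum_add_distrib, e1, e2, neg_add]

lemma IsControlled.mono {uh : Fin 2 → L2 L} {f b₀ ω₀ : L2 L} {T T' M : ℝ}
    {b ω ψ P S : ℝ → L2 L} (h : IsControlled uh f b₀ ω₀ T b ω ψ P S M) (h0 : 0 ≤ T')
    (hT : T' ≤ T) : IsControlled uh f b₀ ω₀ T' b ω ψ P S M := by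
  have hs : Set.Icc 0 T' ⊆ Set.Icc 0 T := Set.Icc_subset_Icc_right hT
  have hs' : Set.uIcc 0 T' ⊆ Set.uIcc 0 T := by
    rwa [Set.uIcc_of_le h0, Set.uIcc_of_le (h0.trans hT)]
  exact ⟨fun t ht => ⟨(h.b_cont t (hs ht)).1,
      (h.b_cont t (hs ht)).2.mono_left (nhdsWithin_mono _ hs)⟩,
    fun t ht => ⟨(h.ω_cont t (hs ht)).1,
      (h.ω_cont t (hs ht)).2.mono_left (nhdsWithin_mono _ hs)⟩,
    fun t ht => h.regular t (hs ht), fun t ht => h.grad_b t (hs ht), h.uh_bdd,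
    fun t ht => h.norm_b t (hs ht), fun t ht => h.norm_ω t (hs ht),
    fun t ht => h.helm t (hs ht), fun t ht => h.inner_P t (hs ht),
    fun t ht => h.inner_S t (hs ht), h.P_int.mono_set hs', h.S_int.mono_set hs',
    fun t ht => h.b_eq t (hs ht), fun t ht => h.ω_eq t (hs ht)⟩

end

/-! ### Uniqueness -/

section

variable {L : ℝ} [Fact (0 < L)]
open Filter Topology

section Difference

variable {uh : Fin 2 → L2 L} {f b₀ ω₀ : L2 L} {T M : ℝ}
  {b₁ ω₁ ψ₁ P₁ S₁ b₂ ω₂ ψ₂ P₂ S₂ : ℝ → L2 L}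

namespace IsControlled

lemma helmholtz_diff (h₁ : IsControlled uh f b₀ ω₀ T b₁ ω₁ ψ₁ P₁ S₁ M)
    (h₂ : IsControlled uh f b₀ ω₀ T b₂ ω₂ ψ₂ P₂ S₂ M)
    {t : ℝ} (ht : t ∈ Set.Icc 0 T) :
    helmholtz (ψ₁ t - ψ₂ t) = ω₁ t - ω₂ t := by
  rw [helmholtz_sub (h₁.regular t ht).memW (h₂.regular t ht).memW, h₁.helm t ht, h₂.helm t ht]
  abel

lemma memW_stream_diff (h₁ : IsControlled uh f b₀ ω₀ T b₁ ω₁ ψ₁ P₁ S₁ M)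
    (h₂ : IsControlled uh f b₀ ω₀ T b₂ ω₂ ψ₂ P₂ S₂ M)
    {t : ℝ} (ht : t ∈ Set.Icc 0 T) : MemW 2 (ψ₁ t - ψ₂ t) :=
  (h₁.regular t ht).memW.sub (h₂.regular t ht).memW

lemma memW_buoyancy_diff (h₁ : IsControlled uh f b₀ ω₀ T b₁ ω₁ ψ₁ P₁ S₁ M)
    (h₂ : IsControlled uh f b₀ ω₀ T b₂ ω₂ ψ₂ P₂ S₂ M)
    {t : ℝ} (ht : t ∈ Set.Icc 0 T) : MemW 1 (b₁ t - b₂ t) :=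
  ((h₁.b_cont t ht).1.sub (h₂.b_cont t ht).1).mono (by norm_num)

lemma inner_P_diff (h₁ : IsControlled uh f b₀ ω₀ T b₁ ω₁ ψ₁ P₁ S₁ M)
    (h₂ : IsControlled uh f b₀ ω₀ T b₂ ω₂ ψ₂ P₂ S₂ M)
    {t : ℝ} (ht : t ∈ Set.Icc 0 T) {v : L2 L} (hv : MemW 1 v) :
    inner ℝ (P₁ t - P₂ t) v =
      -∑ i, inner ℝ (mulL (vel (ψ₁ t) i) (b₁ t) - mulL (vel (ψ₂ t) i) (b₂ t)) (grad v i) := by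
  simp only [inner_sub_left, h₁.inner_P t ht v hv, h₂.inner_P t ht v hv, Finset.sum_sub_distrib]
  ring

lemma inner_S_diff (h₁ : IsControlled uh f b₀ ω₀ T b₁ ω₁ ψ₁ P₁ S₁ M)
    (h₂ : IsControlled uh f b₀ ω₀ T b₂ ω₂ ψ₂ P₂ S₂ M)
    {t : ℝ} (ht : t ∈ Set.Icc 0 T) {v : L2 L} (hv : MemW 1 v) :
    inner ℝ (S₁ t - S₂ t) v =
      -∑ i, inner ℝ (mulL (vel (ψ₁ t) i) (ω₁ t - b₁ t) - mulL (vel (ψ₂ t) i) (ω₂ t - b₂ t) +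
        (mulL (uh i) (b₁ t) - mulL (uh i) (b₂ t))) (grad v i) := by
  simp only [inner_sub_left, inner_add_left, h₁.inner_S t ht v hv, h₂.inner_S t ht v hv,
    Finset.sum_sub_distrib, Finset.sum_add_distrib]
  ring

lemma abs_inner_P_diff_le (h₁ : IsControlled uh f b₀ ω₀ T b₁ ω₁ ψ₁ P₁ S₁ M)
    (h₂ : IsControlled uh f b₀ ω₀ T b₂ ω₂ ψ₂ P₂ S₂ M)
    {t : ℝ} (ht : t ∈ Set.Icc 0 T) {v : L2 L} (hv : MemW 1 v) {N : ℝ}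
    (hN : ∀ i, ‖grad v i‖ ≤ N) : |inner ℝ (P₁ t - P₂ t) v| ≤ 4 * M ^ 2 * N := by
  have hM : 0 ≤ M := (norm_nonneg _).trans (h₁.norm_b t ht)
  rw [h₁.inner_P_diff h₂ ht hv, abs_neg]
  refine (Finset.abs_sum_le_sum_abs _ _).trans ?_
  have : ∀ i ∈ Finset.univ, |inner ℝ (mulL (vel (ψ₁ t) i) (b₁ t) - mulL (vel (ψ₂ t) i) (b₂ t))
      (grad v i)| ≤ (M * M + M * M) * N := by
    intro i _
    refine (abs_real_inner_le_norm _ _).trans ?_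
    gcongr
    · refine (norm_sub_le _ _).trans (add_le_add ?_ ?_)
      · exact (((h₁.regular t ht).essBdd_vel i).norm_mulL_le _).trans (by
          gcongr; exact h₁.norm_b t ht)
      · exact (((h₂.regular t ht).essBdd_vel i).norm_mulL_le _).trans (by
          gcongr; exact h₂.norm_b t ht)
    · exact hN i
  refine (Finset.sum_le_sum this).trans (le_of_eq ?_)
  simp only [Fin.sum_univ_two]
  ring

lemma abs_inner_S_diff_le (h₁ : IsControlled uh f b₀ ω₀ T b₁ ω₁ ψ₁ P₁ S₁ M)
    (h₂ : IsControlled uh f b₀ ω₀ T b₂ ω₂ ψ₂ P₂ S₂ M)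
    {t : ℝ} (ht : t ∈ Set.Icc 0 T) {v : L2 L} (hv : MemW 1 v) {N : ℝ}
    (hN : ∀ i, ‖grad v i‖ ≤ N) : |inner ℝ (S₁ t - S₂ t) v| ≤ 12 * M ^ 2 * N := by
  have hM : 0 ≤ M := (norm_nonneg _).trans (h₁.norm_b t ht)
  rw [h₁.inner_S_diff h₂ ht hv, abs_neg]
  refine (Finset.abs_sum_le_sum_abs _ _).trans ?_
  have hflux : ∀ {ψ ω b : L2 L} (_ : IsRegular ψ M) (_ : ‖ω‖ ≤ M) (_ : ‖b‖ ≤ M) (i : Fin 2),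
      ‖mulL (vel ψ i) (ω - b)‖ ≤ M * (M + M) := by
    intro ψ ω b hψ hω hb i
    refine ((hψ.essBdd_vel i).norm_mulL_le _).trans ?_
    gcongr
    exact (norm_sub_le _ _).trans (add_le_add hω hb)
  have : ∀ i ∈ Finset.univ, |inner ℝ (mulL (vel (ψ₁ t) i) (ω₁ t - b₁ t) -
      mulL (vel (ψ₂ t) i) (ω₂ t - b₂ t) + (mulL (uh i) (b₁ t) - mulL (uh i) (b₂ t)))
      (grad v i)| ≤ (M * (M + M) + M * (M + M) + (M * M + M * M)) * N := by
    intro i _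
    refine (abs_real_inner_le_norm _ _).trans ?_
    gcongr
    · refine (norm_add_le _ _).trans (add_le_add ((norm_sub_le _ _).trans (add_le_add ?_ ?_))
        ((norm_sub_le _ _).trans (add_le_add ?_ ?_)))
      · exact hflux (h₁.regular t ht) (h₁.norm_ω t ht) (h₁.norm_b t ht) i
      · exact hflux (h₂.regular t ht) (h₂.norm_ω t ht) (h₂.norm_b t ht) i
      · exact ((h₁.uh_bdd i).norm_mulL_le _).trans (by gcongr; exact h₁.norm_b t ht)
      · exact ((h₁.uh_bdd i).norm_mulL_le _).trans (by gcongr; exact h₂.norm_b t ht)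
    · exact hN i
  refine (Finset.sum_le_sum this).trans (le_of_eq ?_)
  simp only [Fin.sum_univ_two]
  ring

/-- The energy production on the diagonal. -/
lemma production_le (h₁ : IsControlled uh f b₀ ω₀ T b₁ ω₁ ψ₁ P₁ S₁ M)
    (h₂ : IsControlled uh f b₀ ω₀ T b₂ ω₂ ψ₂ P₂ S₂ M)
    {t : ℝ} (ht : t ∈ Set.Icc 0 T) :
    2 * (|inner ℝ (P₁ t - P₂ t) (b₁ t - b₂ t)| + |inner ℝ (S₁ t - S₂ t) (ψ₁ t - ψ₂ t)|) ≤
      10 * M * (‖b₁ t - b₂ t‖ ^ 2 + energy (ψ₁ t - ψ₂ t)) := by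
  have hM : 0 ≤ M := (norm_nonneg _).trans (h₁.norm_b t ht)
  have k1 := (h₁.regular t ht).abs_sum_inner_buoyancy_le (h₂.regular t ht)
    ((h₁.b_cont t ht).1.mono (by norm_num)) ((h₂.b_cont t ht).1.mono (by norm_num))
    (h₂.grad_b t ht)
  have k2 := (h₁.regular t ht).abs_sum_inner_vorticity_le (h₂.regular t ht)
    (b₁ := b₁ t) (b₂ := b₂ t) h₁.uh_bdd (h₁.helmholtz_diff h₂ ht).symm
  rw [h₁.inner_P_diff h₂ ht (h₁.memW_buoyancy_diff h₂ ht), abs_neg,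
    h₁.inner_S_diff h₂ ht ((h₁.memW_stream_diff h₂ ht).mono (by norm_num)), abs_neg]
  have hen : energy (ψ₁ t - ψ₂ t) = ‖ψ₁ t - ψ₂ t‖ ^ 2 +
      (‖grad (ψ₁ t - ψ₂ t) 0‖ ^ 2 + ‖grad (ψ₁ t - ψ₂ t) 1‖ ^ 2) := by
    rw [energy, Fin.sum_univ_two]
  rw [hen]
  clear hen
  generalize ‖grad (ψ₁ t - ψ₂ t) 0‖ = x at *
  generalize ‖grad (ψ₁ t - ψ₂ t) 1‖ = y at *
  generalize ‖b₁ t - b₂ t‖ = z at *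
  generalize ‖ψ₁ t - ψ₂ t‖ = w at *
  have e1 : (x + y) * z ≤ x ^ 2 + y ^ 2 + z ^ 2 := by
    nlinarith [sq_nonneg (x - z), sq_nonneg (y - z), sq_nonneg x, sq_nonneg y]
  have e2 : (x + y) ^ 2 ≤ 2 * (x ^ 2 + y ^ 2) := by nlinarith [sq_nonneg (x - y)]
  have e1' := mul_le_mul_of_nonneg_left e1 hM
  have e2' := mul_le_mul_of_nonneg_left e2 hM
  have e3 := mul_nonneg hM (sq_nonneg w)
  have e4 := mul_nonneg hM (sq_nonneg z)
  linarith

lemma helmholtz_diff_sub (h₁ : IsControlled uh f b₀ ω₀ T b₁ ω₁ ψ₁ P₁ S₁ M)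
    (h₂ : IsControlled uh f b₀ ω₀ T b₂ ω₂ ψ₂ P₂ S₂ M)
    {s t : ℝ} (hs : s ∈ Set.Icc 0 T) (ht : t ∈ Set.Icc 0 T) :
    helmholtz ((ψ₁ t - ψ₂ t) - (ψ₁ s - ψ₂ s)) = (ω₁ t - ω₂ t) - (ω₁ s - ω₂ s) := by
  rw [helmholtz_sub (h₁.memW_stream_diff h₂ ht) (h₁.memW_stream_diff h₂ hs),
    h₁.helmholtz_diff h₂ ht, h₁.helmholtz_diff h₂ hs]

lemma continuousOn_stream_diff (h₁ : IsControlled uh f b₀ ω₀ T b₁ ω₁ ψ₁ P₁ S₁ M)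
    (h₂ : IsControlled uh f b₀ ω₀ T b₂ ω₂ ψ₂ P₂ S₂ M) :
    ContinuousOn (fun t => ψ₁ t - ψ₂ t) (Set.Icc 0 T) := by
  have hW := h₁.ω_cont.continuousOn.sub h₂.ω_cont.continuousOn
  intro s hs
  have := tendsto_iff_norm_sub_tendsto_zero.1 (hW s hs)
  refine tendsto_iff_norm_sub_tendsto_zero.2
    (squeeze_zero' (Eventually.of_forall fun _ => norm_nonneg _) ?_ this)
  filter_upwards [self_mem_nhdsWithin] with t ht
  have := norm_le_norm_helmholtz
    ((h₁.memW_stream_diff h₂ ht).sub (h₁.memW_stream_diff h₂ hs))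
  rwa [h₁.helmholtz_diff_sub h₂ hs ht] at this

lemma continuousOn_grad_stream_diff (h₁ : IsControlled uh f b₀ ω₀ T b₁ ω₁ ψ₁ P₁ S₁ M)
    (h₂ : IsControlled uh f b₀ ω₀ T b₂ ω₂ ψ₂ P₂ S₂ M)
    (i : Fin 2) :
    ContinuousOn (fun t => grad (ψ₁ t - ψ₂ t) i) (Set.Icc 0 T) := by
  have hW := h₁.ω_cont.continuousOn.sub h₂.ω_cont.continuousOn
  intro s hs
  have := tendsto_iff_norm_sub_tendsto_zero.1 (hW s hs)
  refine tendsto_iff_norm_sub_tendsto_zero.2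
    (squeeze_zero' (Eventually.of_forall fun _ => norm_nonneg _) ?_ this)
  filter_upwards [self_mem_nhdsWithin] with t ht
  have := norm_grad_le ((h₁.memW_stream_diff h₂ ht).sub (h₁.memW_stream_diff h₂ hs)) i
  rwa [h₁.helmholtz_diff_sub h₂ hs ht,
    grad_sub (h₁.memW_stream_diff h₂ ht) (h₁.memW_stream_diff h₂ hs)] at this

lemma continuousOn_grad_buoyancy_diff (h₁ : IsControlled uh f b₀ ω₀ T b₁ ω₁ ψ₁ P₁ S₁ M)
    (h₂ : IsControlled uh f b₀ ω₀ T b₂ ω₂ ψ₂ P₂ S₂ M)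
    (i : Fin 2) :
    ContinuousOn (fun t => grad (b₁ t - b₂ t) i) (Set.Icc 0 T) := by
  have h : (unitIndex i).1 + (unitIndex i).2 ≤ 3 := by rw [unitIndex_sum]; norm_num
  refine ((h₁.b_cont.continuousOn_weakDeriv h).sub
    (h₂.b_cont.continuousOn_weakDeriv h)).congr fun t ht => ?_
  exact weakDeriv_sub (h₁.b_cont t ht).1 (h₂.b_cont t ht).1 h

/-- Uniqueness, by the energy method for the norm `‖b‖² + ‖ψ‖² + ‖∇ψ‖²`. -/
theorem eq_of_same_data (h₁ : IsControlled uh f b₀ ω₀ T b₁ ω₁ ψ₁ P₁ S₁ M)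
    (h₂ : IsControlled uh f b₀ ω₀ T b₂ ω₂ ψ₂ P₂ S₂ M)
    (hT : 0 ≤ T) {t : ℝ} (ht : t ∈ Set.Icc 0 T) :
    b₁ t = b₂ t ∧ ω₁ t = ω₂ t := by
  have hM0 : 0 ≤ M := (norm_nonneg _).trans (h₁.norm_b t ht)
  set E : ℝ → ℝ := fun t => ‖b₁ t - b₂ t‖ ^ 2 + energy (ψ₁ t - ψ₂ t) with hE
  set Y : ℝ → (Fin 2 → L2 L) × (Fin 2 → L2 L) :=
    fun t => (fun i => grad (b₁ t - b₂ t) i, fun i => grad (ψ₁ t - ψ₂ t) i) with hY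
  have hE_eq : ∀ s ∈ Set.Icc 0 T, E s = inner ℝ (b₁ s - b₂ s) (b₁ s - b₂ s) -
      inner ℝ (ω₁ s - ω₂ s) (ψ₁ s - ψ₂ s) := by
    intro s hs
    rw [hE, ← h₁.helmholtz_diff h₂ hs]
    simp only [energy_eq (h₁.memW_stream_diff h₂ hs), real_inner_self_eq_norm_sq]
    ring
  have hEc : ContinuousOn E (Set.Icc 0 T) :=
    ((h₁.b_cont.continuousOn.sub h₂.b_cont.continuousOn).norm.pow 2).add
      (((h₁.continuousOn_stream_diff h₂).norm.pow 2).add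
        (continuousOn_finsetSum _ fun i _ =>
          (h₁.continuousOn_grad_stream_diff h₂ i).norm.pow 2))
  have hYc : ContinuousOn Y (Set.Icc 0 T) :=
    (continuousOn_pi.2 fun i => h₁.continuousOn_grad_buoyancy_diff h₂ i).prodMk
      (continuousOn_pi.2 fun i => h₁.continuousOn_grad_stream_diff h₂ i)
  have h0 : (0 : ℝ) ∈ Set.Icc 0 T := ⟨le_rfl, hT⟩
  have hE0 : E 0 ≤ 0 := by
    rw [hE_eq 0 h0, h₁.b_eq 0 h0, h₂.b_eq 0 h0, h₁.ω_eq 0 h0, h₂.ω_eq 0 h0]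
    simp
  have key := nonpos_of_increment_le (K := 10 * M) (C := 16 * M ^ 2) (by positivity) hEc hYc hE0 ?_
  · have hle := key t ht
    simp only [hE, energy] at hle
    have hg : 0 ≤ ∑ i, ‖grad (ψ₁ t - ψ₂ t) i‖ ^ 2 := Finset.sum_nonneg fun _ _ => by positivity
    have hb : ‖b₁ t - b₂ t‖ ^ 2 = 0 := by
      linarith [sq_nonneg ‖b₁ t - b₂ t‖, sq_nonneg ‖ψ₁ t - ψ₂ t‖]
    have hψ : ‖ψ₁ t - ψ₂ t‖ ^ 2 = 0 := by
      linarith [sq_nonneg ‖b₁ t - b₂ t‖, sq_nonneg ‖ψ₁ t - ψ₂ t‖]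
    rw [sq_eq_zero_iff, norm_sub_eq_zero_iff] at hb hψ
    have hω := h₁.helm t ht
    rw [hψ, h₂.helm t ht, sub_left_inj] at hω
    exact ⟨hb, hω.symm⟩
  intro s hs t ht hst
  have hsub : Set.uIcc s t ⊆ Set.uIcc 0 T := by
    rw [Set.uIcc_of_le hst, Set.uIcc_of_le hT]
    exact Set.Icc_subset_Icc hs.1 ht.2
  have hsub' : ∀ {r : ℝ}, r ∈ Set.Icc 0 T → Set.uIcc 0 r ⊆ Set.uIcc 0 T := by
    intro r hr
    rw [Set.uIcc_of_le hr.1, Set.uIcc_of_le hT]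
    exact Set.Icc_subset_Icc le_rfl hr.2
  have hincr : ∀ {x₁ x₂ p₁ p₂ : ℝ → L2 L} {x₀ : L2 L}, IntervalIntegrable p₁ volume 0 T →
      IntervalIntegrable p₂ volume 0 T →
      (∀ r ∈ Set.Icc 0 T, x₁ r = x₀ - ∫ τ in (0 : ℝ)..r, p₁ τ) →
      (∀ r ∈ Set.Icc 0 T, x₂ r = x₀ - ∫ τ in (0 : ℝ)..r, p₂ τ) →
      (x₁ t - x₂ t) - (x₁ s - x₂ s) = -∫ τ in s..t, (p₁ τ - p₂ τ) := by
    intro x₁ x₂ p₁ p₂ x₀ hp₁ hp₂ hx₁ hx₂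
    rw [intervalIntegral.integral_sub (hp₁.mono_set hsub) (hp₂.mono_set hsub),
      ← intervalIntegral.integral_interval_sub_left (hp₁.mono_set (hsub' ht))
        (hp₁.mono_set (hsub' hs)),
      ← intervalIntegral.integral_interval_sub_left (hp₂.mono_set (hsub' ht))
        (hp₂.mono_set (hsub' hs)), hx₁ t ht, hx₁ s hs, hx₂ t ht, hx₂ s hs]
    abel
  have hpint : IntervalIntegrable (fun τ => P₁ τ - P₂ τ) volume s t :=
    (h₁.P_int.sub h₂.P_int).mono_set hsub
  have hqint : IntervalIntegrable (fun τ => S₁ τ - S₂ τ) volume s t :=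
    (h₁.S_int.sub h₂.S_int).mono_set hsub
  have i1 := inner_increment (y := b₁ s - b₂ s) (y' := b₁ t - b₂ t) hpint
    (hincr h₁.P_int h₂.P_int h₁.b_eq h₂.b_eq) (real_inner_comm _ _)
  have i2 := inner_increment (y := ψ₁ s - ψ₂ s) (y' := ψ₁ t - ψ₂ t) hqint
    (hincr h₁.S_int h₂.S_int h₁.ω_eq h₂.ω_eq) (by
      rw [← h₁.helmholtz_diff h₂ ht, ← h₁.helmholtz_diff h₂ hs]
      exact inner_helmholtz_comm (h₁.memW_stream_diff h₂ ht) (h₁.memW_stream_diff h₂ hs))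
  have hint : ∀ {p : ℝ → L2 L} (v : L2 L), IntervalIntegrable p volume s t →
      IntervalIntegrable (fun τ => -inner ℝ (p τ) v) volume s t := by
    intro p v hp
    have h : IntervalIntegrable (fun τ => innerSL ℝ v (p τ)) volume s t :=
      ⟨((innerSL ℝ) v).integrable_comp hp.1, ((innerSL ℝ) v).integrable_comp hp.2⟩
    simpa only [innerSL_apply_apply, real_inner_comm] using! h.neg
  refine ⟨fun τ => -inner ℝ (P₁ τ - P₂ τ) ((b₁ t - b₂ t) + (b₁ s - b₂ s)) -
    -inner ℝ (S₁ τ - S₂ τ) ((ψ₁ t - ψ₂ t) + (ψ₁ s - ψ₂ s)), (hint _ hpint).sub (hint _ hqint),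
    ?_, fun τ hτ => ?_⟩
  · rw [intervalIntegral.integral_sub (hint _ hpint) (hint _ hqint), ← i1, ← i2, hE_eq t ht,
      hE_eq s hs]
    exact le_of_eq (by ring)
  have hτT : τ ∈ Set.Icc 0 T := ⟨hs.1.trans hτ.1, hτ.2.trans ht.2⟩
  have hdiag := h₁.production_le h₂ hτT
  have hoffP : ∀ r ∈ Set.Icc 0 T,
      |inner ℝ (P₁ τ - P₂ τ) ((b₁ r - b₂ r) - (b₁ τ - b₂ τ))| ≤ 4 * M ^ 2 * ‖Y r - Y τ‖ := by
    intro r hr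
    refine h₁.abs_inner_P_diff_le h₂ hτT
      ((h₁.memW_buoyancy_diff h₂ hr).sub (h₁.memW_buoyancy_diff h₂ hτT)) fun i => ?_
    rw [grad_sub (n := 0) (h₁.memW_buoyancy_diff h₂ hr) (h₁.memW_buoyancy_diff h₂ hτT)]
    exact (norm_le_pi_norm (Y r - Y τ).1 i).trans (norm_fst_le _)
  have hoffS : ∀ r ∈ Set.Icc 0 T,
      |inner ℝ (S₁ τ - S₂ τ) ((ψ₁ r - ψ₂ r) - (ψ₁ τ - ψ₂ τ))| ≤ 12 * M ^ 2 * ‖Y r - Y τ‖ := by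
    intro r hr
    refine h₁.abs_inner_S_diff_le h₂ hτT
      (((h₁.memW_stream_diff h₂ hr).sub (h₁.memW_stream_diff h₂ hτT)).mono (by norm_num))
      fun i => ?_
    rw [grad_sub (h₁.memW_stream_diff h₂ hr) (h₁.memW_stream_diff h₂ hτT)]
    exact (norm_le_pi_norm (Y r - Y τ).2 i).trans (norm_snd_le _)
  have a1 := hoffP t ht
  have a2 := hoffP s hs
  have a3 := hoffS t ht
  have a4 := hoffS s hs
  rw [inner_sub_right, abs_le] at a1 a2 a3 a4
  have d1 := neg_abs_le (inner ℝ (P₁ τ - P₂ τ) (b₁ τ - b₂ τ))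
  have d2 := le_abs_self (inner ℝ (S₁ τ - S₂ τ) (ψ₁ τ - ψ₂ τ))
  simp only [inner_add_right]
  change _ ≤ 10 * M * (‖b₁ τ - b₂ τ‖ ^ 2 + energy (ψ₁ τ - ψ₂ τ)) + _
  linarith [a1.1, a2.1, a3.2, a4.2]

end IsControlled

end Difference

end

end TQG

end

theorem mainTheorem4 (L : ℝ) [Fact (0 < L)]
    (uh : Fin 2 → TQG.L2 L) (f b₀ ω₀ : TQG.L2 L) (hdata : TQG.IsData uh f b₀ ω₀)
    (b₁ ω₁ b₂ ω₂ : ℝ → TQG.L2 L) (T₁ T₂ : ℝ)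
    (h₁ : TQG.IsSolution uh f b₀ ω₀ b₁ ω₁ T₁)
    (h₂ : TQG.IsSolution uh f b₀ ω₀ b₂ ω₂ T₂) :
    ∀ t ∈ Set.Icc 0 (min T₁ T₂),
      TQG.sobolevNorm 2 (b₁ t - b₂ t) ^ 2 + TQG.sobolevNorm 1 (ω₁ t - ω₂ t) ^ 2 = 0 := by
  intro t ht
  obtain ⟨ψ₁, P₁, S₁, M₁, c₁⟩ := h₁.exists_isControlled hdata
  obtain ⟨ψ₂, P₂, S₂, M₂, c₂⟩ := h₂.exists_isControlled hdata
  have hT : 0 ≤ min T₁ T₂ := (lt_min h₁.pos h₂.pos).le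
  obtain ⟨hb, hω⟩ := ((c₁ _ (le_max_left M₁ M₂)).mono hT (min_le_left _ _)).eq_of_same_data
    ((c₂ _ (le_max_right M₁ M₂)).mono hT (min_le_right _ _)) hT ht
  rw [hb, hω, sub_self, sub_self, TQG.sobolevNorm_zero, TQG.sobolevNorm_zero]
  norm_num
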